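/- Let $T>0$ and $d\ge 0$. Let $\alpha,\sigma,\eta:[0,T]\to\mathbb R$ be such that $\alpha_t$, $\eta_t$ and $\sigma_t^2$ are differentiable on $[0,T]$ (one-sidedly at the end points) with bounded derivatives, $\alpha_t>0$ and $\eta_t<1$ for all $t\in[0,T]$, and $\alpha_0=1$, $\sigma_0=0$, $\eta_0=0$. Put $$f(t)=\frac{d\log(\alpha_t(1-\eta_t))}{dt},\qquad h(t)=\frac{\alpha_t}{1-\eta_t}\frac{d\eta_t}{dt},\qquad g(t)=\sqrt{\frac{d\sigma_t^2}{dt}-2\,\frac{d\log(\alpha_t(1-\eta_t))}{dt}\,\sigma_t^2},$$ and suppose that the radicand in the definition of $g$ is nonnegative on $[0,T]$. Let $(w_t)_{t\in[0,T]}$ be a standard $d$-dimensional Wiener process relative to a filtration $(\mathcal F_t)$ on a probability space, let $\hat x_0$ be an $\mathcal F_0$-measurable random vector in $\mathbb R^d$, and let $(x_t)_{t\in[0,T]}$ be an adapted process with almost surely continuous paths (with an arbitrary initial law $x_0\sim q_0$) that solves the linear Itô SDE $$dx_t=[f(t)\,x_t+h(t)\,\hat x_0]\,dt+g(t)\,dw_t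 .$$ Then for every $t\in[0,T]$ the conditional law of $x_t$ given $(x_0,\hat x_0)$ is, almost surely, the domain-shift Gaussian $$q(x_t\mid x_0,\hat x_0)=\mathcal N\big(\alpha_t(\eta_t\hat x_0+(1-\eta_t)x_0),\ \sigma_t^2 I\big).$$ In particular, if $x_0$ and $\hat x_0$ are deterministic, then $x_t\sim\mathcal N\big(\alpha_t(\eta_t\hat x_0+(1-\eta_t)x_0),\sigma_t^2 I\big)$ for every $t\in[0,T]$. -/

import Mathlib

open MeasureTheory ProbabilityTheory Set Filter Topology

namespace DoS

noncomputable section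

/-- The state space `ℝᵈ` with its Euclidean norm. -/
abbrev Space (d : ℕ) : Type := EuclideanSpace ℝ (Fin d)

/-- The isotropic Gaussian law `N(m, v I)` on `ℝᵈ`, for `v ≥ 0`. -/
def isoGaussian {d : ℕ} (m : Space d) (v : ℝ) : Measure (Space d) :=
  multivariateGaussian m (v • (1 : Matrix (Fin d) (Fin d) ℝ))

/-- `W` is a standard `d`-dimensional Wiener process on `[0, T]` relative to the filtration `𝓕`.
Processes are indexed by `ℝ`, but only their values at times in `[0, T]` matter. -/
structure IsWienerProcess {Ω : Type*} {mΩ : MeasurableSpace Ω} {d : ℕ}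
    (𝓕 : Filtration ℝ mΩ) (P : Measure Ω) (T : ℝ) (W : ℝ → Ω → Space d) : Prop where
  adapted : ∀ t ∈ Icc 0 T, Measurable[𝓕 t] (W t)
  zero : ∀ᵐ ω ∂P, W 0 ω = 0
  indep : ∀ s ∈ Icc 0 T, ∀ t ∈ Icc s T,
    Indep (MeasurableSpace.comap (fun ω ↦ W t ω - W s ω) inferInstance) (𝓕 s) P
  law : ∀ s ∈ Icc 0 T, ∀ t ∈ Icc s T, HasLaw (fun ω ↦ W t ω - W s ω) (isoGaussian 0 (t - s)) P
  continuous : ∀ᵐ ω ∂P, ContinuousOn (fun t ↦ W t ω) (Icc 0 T)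

/-- An elementary integrand `∑_{i < n} ξ_i 1_{(t_i, t_{i+1}]}` with `0 ≤ t_0 ≤ t_1 ≤ ⋯` and
`ξ_i` bounded and `𝓕_{t_i}`-measurable. -/
structure ElementaryProcess {Ω : Type*} {mΩ : MeasurableSpace Ω} (𝓕 : Filtration ℝ mΩ) where
  n : ℕ
  time : ℕ → ℝ
  coeff : ℕ → Ω → ℝ
  time_nonneg : 0 ≤ time 0
  time_mono : Monotone time
  coeff_measurable : ∀ i, Measurable[𝓕 (time i)] (coeff i)
  coeff_bounded : ∀ i, ∃ C : ℝ, ∀ ω, |coeff i ω| ≤ C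

/-- The value at time `t` of an elementary integrand. -/
def ElementaryProcess.value {Ω : Type*} {mΩ : MeasurableSpace Ω} {𝓕 : Filtration ℝ mΩ}
    (V : ElementaryProcess 𝓕) (t : ℝ) (ω : Ω) : ℝ :=
  ∑ i ∈ Finset.range V.n, (Ioc (V.time i) (V.time (i + 1))).indicator (fun _ ↦ V.coeff i ω) t

/-- The stochastic integral `∫_0^t V dW = ∑_{i < n} ξ_i (W_{t_{i+1} ∧ t} - W_{t_i ∧ t})`
of an elementary integrand. -/
def ElementaryProcess.integral {Ω : Type*} {mΩ : MeasurableSpace Ω} {𝓕 : Filtration ℝ mΩ} {d : ℕ}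
    (V : ElementaryProcess 𝓕) (W : ℝ → Ω → Space d) (t : ℝ) (ω : Ω) : Space d :=
  ∑ i ∈ Finset.range V.n,
    V.coeff i ω • (W (min (V.time (i + 1)) t) ω - W (min (V.time i) t) ω)

/-- `M` is (a version of) the Itô integral process `M_t = ∫_0^t H_s dW_s`, `t ∈ [0, T]`, of the
scalar integrand `H`: there are elementary integrands `V_n` with `E ∫_0^T |V_n - H|² ds → 0`, and
`∫_0^t V_n dW → M_t` in `L²(P)` for every `t ∈ [0, T]`. -/
def IsItoIntegral {Ω : Type*} {mΩ : MeasurableSpace Ω} {d : ℕ}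
    (𝓕 : Filtration ℝ mΩ) (P : Measure Ω) (T : ℝ) (W : ℝ → Ω → Space d)
    (H : ℝ → Ω → ℝ) (M : ℝ → Ω → Space d) : Prop :=
  (∀ t ∈ Icc 0 T, AEStronglyMeasurable (M t) P) ∧
  ∃ V : ℕ → ElementaryProcess 𝓕,
    Tendsto (fun n ↦ ∫⁻ ω, ∫⁻ s in Icc 0 T, ‖(V n).value s ω - H s ω‖ₑ ^ 2 ∂volume ∂P)
      atTop (𝓝 0) ∧
    ∀ t ∈ Icc 0 T,
      Tendsto (fun n ↦ ∫⁻ ω, ‖(V n).integral W t ω - M t ω‖ₑ ^ 2 ∂P) atTop (𝓝 0)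

/-- `X` solves the linear Itô SDE `dX_t = [f(t) X_t + h(t) x̂] dt + g(t) dW_t` on `[0, T]`. -/
structure IsLinearSDESolution {Ω : Type*} {mΩ : MeasurableSpace Ω} {d : ℕ}
    (𝓕 : Filtration ℝ mΩ) (P : Measure Ω) (T : ℝ) (W : ℝ → Ω → Space d)
    (f h g : ℝ → ℝ) (xhat : Ω → Space d) (X : ℝ → Ω → Space d) : Prop where
  adapted : ∀ t ∈ Icc 0 T, Measurable[𝓕 t] (X t)
  continuous : ∀ᵐ ω ∂P, ContinuousOn (fun t ↦ X t ω) (Icc 0 T)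
  drift_integrable : ∀ᵐ ω ∂P,
    IntervalIntegrable (fun s ↦ f s • X s ω + h s • xhat ω) volume 0 T
  integral_eq : ∃ M : ℝ → Ω → Space d, IsItoIntegral 𝓕 P T W (fun s _ ↦ g s) M ∧
    ∀ᵐ ω ∂P, ∀ t ∈ Icc 0 T,
      X t ω = X 0 ω + (∫ s in (0 : ℝ)..t, (f s • X s ω + h s • xhat ω)) + M t ω

/-- `f(t) = d log(α_t (1 - η_t)) / dt`, for schedules given on `[0, T]`
(one-sided derivatives at the end points). -/
def coeffF (T : ℝ) (α η : ℝ → ℝ) (t : ℝ) : ℝ :=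
  derivWithin (fun s ↦ Real.log (α s * (1 - η s))) (Icc 0 T) t

/-- `h(t) = α_t / (1 - η_t) · dη_t / dt`. -/
def coeffH (T : ℝ) (α η : ℝ → ℝ) (t : ℝ) : ℝ :=
  α t / (1 - η t) * derivWithin η (Icc 0 T) t

/-- The radicand `dσ_t² / dt - 2 (d log(α_t (1 - η_t)) / dt) σ_t²` of `g(t)²`. -/
def coeffGSq (T : ℝ) (α σ η : ℝ → ℝ) (t : ℝ) : ℝ :=
  derivWithin (fun s ↦ σ s ^ 2) (Icc 0 T) t
    - 2 * derivWithin (fun s ↦ Real.log (α s * (1 - η s))) (Icc 0 T) t * σ t ^ 2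

/-- `g(t) = √(dσ_t² / dt - 2 (d log(α_t (1 - η_t)) / dt) σ_t²)`. -/
def coeffG (T : ℝ) (α σ η : ℝ → ℝ) (t : ℝ) : ℝ :=
  Real.sqrt (coeffGSq T α σ η t)

/-- The domain-shift Gaussian `N(α_t (η_t x̂₀ + (1 - η_t) x₀), σ_t² I)`. -/
def domainShiftGaussian {d : ℕ} (α σ η : ℝ → ℝ) (t : ℝ) (x₀ xhat₀ : Space d) :
    Measure (Space d) :=
  isoGaussian (α t • (η t • xhat₀ + (1 - η t) • x₀)) (σ t ^ 2)

/-- `u` is differentiable on `[0, T]` with bounded derivative. -/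
def DiffBddDeriv (T : ℝ) (u : ℝ → ℝ) : Prop :=
  DifferentiableOn ℝ u (Icc 0 T) ∧ ∃ C : ℝ, ∀ t ∈ Icc 0 T, |derivWithin u (Icc 0 T) t| ≤ C

end

end DoS

namespace DoS

open scoped InnerProductSpace ENNReal NNReal

lemma charFun_isoGaussian {d : ℕ} (m : Space d) {v : ℝ} (hv : 0 ≤ v) (u : Space d) :
    charFun (isoGaussian m v) u
      = Complex.exp (⟪u, m⟫_ℝ * Complex.I - ((v * ‖u‖ ^ 2 / 2 : ℝ) : ℂ)) := by
  have hS : (v • (1 : Matrix (Fin d) (Fin d) ℝ)).PosSemidef := Matrix.PosSemidef.one.smul hv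
  rw [isoGaussian, charFun_multivariateGaussian hS]
  congr 2
  have : (u.ofLp ⬝ᵥ (v • (1 : Matrix (Fin d) (Fin d) ℝ)).mulVec u.ofLp) = v * ‖u‖ ^ 2 := by
    rw [Matrix.smul_mulVec, Matrix.one_mulVec, dotProduct_smul, EuclideanSpace.real_norm_sq_eq,
      smul_eq_mul]
    simp [dotProduct, sq]
  rw [this]
  push_cast
  ring

instance isGaussian_isoGaussian {d : ℕ} (m : Space d) (v : ℝ) : IsGaussian (isoGaussian m v) := by
  unfold isoGaussian; infer_instance

lemma map_add_smul_isoGaussian {d : ℕ} (m : Space d) (c : ℝ) {v : ℝ} (hv : 0 ≤ v) :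
    (isoGaussian 0 v).map (fun x : Space d ↦ m + c • x) = isoGaussian m (c ^ 2 * v) := by
  have : IsProbabilityMeasure ((isoGaussian 0 v).map (fun x : Space d ↦ m + c • x)) :=
    Measure.isProbabilityMeasure_map (by fun_prop)
  refine Measure.ext_of_charFun ?_
  ext u
  have h1 : (fun x : Space d ↦ m + c • x) = (fun x ↦ m + x) ∘ (fun x ↦ c • x) := rfl
  rw [h1, ← Measure.map_map (by fun_prop) (by fun_prop)]
  rw [charFun_isoGaussian _ (by positivity), charFun_map_const_add, charFun_map_smul,
    charFun_isoGaussian _ hv, ← Complex.exp_add]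
  congr 1
  simp only [inner_zero_right, norm_smul, Real.norm_eq_abs, mul_pow, sq_abs]
  push_cast
  simp [real_inner_comm]
  ring

lemma exists_integral_norm_sq_isoGaussian (d : ℕ) :
    ∃ C : ℝ, 0 ≤ C ∧ ∀ v, 0 ≤ v → ∫ x, ‖x‖ ^ 2 ∂(isoGaussian (0 : Space d) v) = C * v := by
  refine ⟨∫ x, ‖x‖ ^ 2 ∂(isoGaussian (0 : Space d) 1), integral_nonneg fun _ ↦ by positivity,
    fun v hv ↦ ?_⟩
  have h := map_add_smul_isoGaussian (0 : Space d) (√v) (zero_le_one)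
  rw [Real.sq_sqrt hv, mul_one] at h
  rw [← h, integral_map (by fun_prop) (by fun_prop), ← integral_mul_const]
  congr 1 with x
  simp [norm_smul, mul_pow, Real.sq_sqrt hv, mul_comm]

/-- `D` is independent of `m` with law `N(0, q I)`, expressed through characteristic functions. -/
def IsGaussianGiven {Ω : Type*} (m : MeasurableSpace Ω) {_ : MeasurableSpace Ω} {d : ℕ}
    (P : Measure Ω) (D : Ω → Space d) (q : ℝ) : Prop :=
  ∀ u : Space d, ∀ ξ : Ω → ℂ, Measurable[m] ξ → (∀ ω, ‖ξ ω‖ ≤ 1) →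
    ∫ ω, ξ ω * Complex.exp (⟪D ω, u⟫_ℝ * Complex.I) ∂P
      = (∫ ω, ξ ω ∂P) * Complex.exp (-((q * ‖u‖ ^ 2 / 2 : ℝ) : ℂ))

section

variable {Ω : Type*} {m mΩ : MeasurableSpace Ω} {d : ℕ} {P : Measure Ω}

lemma isGaussianGiven_of_indep (hm : m ≤ mΩ) {D : Ω → Space d} {q : ℝ}
    (hq : 0 ≤ q) (hD : Measurable D)
    (hind : Indep (MeasurableSpace.comap D inferInstance) m P)
    (hlaw : HasLaw D (isoGaussian 0 q) P) : IsGaussianGiven m P D q := by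
  intro u ξ hξ _
  have hi : IndepFun ξ (fun ω ↦ Complex.exp (⟪D ω, u⟫_ℝ * Complex.I)) P := by
    rw [IndepFun_iff_Indep]
    refine (indep_of_indep_of_le_left (indep_of_indep_of_le_right hind hξ.comap_le) ?_).symm
    have : Measurable (fun x : Space d ↦ Complex.exp (⟪x, u⟫_ℝ * Complex.I)) := by fun_prop
    exact (this.comp (comap_measurable D)).comap_le
  rw [hi.integral_fun_mul_eq_mul_integral (hξ.mono hm le_rfl).aestronglyMeasurable
    (Measurable.aestronglyMeasurable (by fun_prop))]
  congr 1
  have h := charFun_isoGaussian (0 : Space d) hq u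
  rw [← hlaw.map_eq, charFun_apply, integral_map (by fun_prop) (by fun_prop)] at h
  rw [h]
  simp

lemma IsGaussianGiven.sum (𝓖 : ℕ → MeasurableSpace Ω) (hmono : Monotone 𝓖)
    (D : ℕ → Ω → Space d) (q c : ℕ → ℝ) (hD : ∀ i, Measurable[𝓖 (i + 1)] (D i))
    (h : ∀ i, IsGaussianGiven (𝓖 i) P (D i) (q i)) (n : ℕ) :
    IsGaussianGiven (𝓖 0) P (fun ω ↦ ∑ i ∈ Finset.range n, c i • D i ω)
      (∑ i ∈ Finset.range n, c i ^ 2 * q i) := by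
  intro u ξ hξ hb
  induction n with
  | zero => simp
  | succ n ih =>
    have hS : Measurable[𝓖 n] (fun ω ↦ ∑ i ∈ Finset.range n, c i • D i ω) := by
      refine Finset.measurable_fun_sum _ fun i hi ↦ ?_
      exact ((hD i).mono (hmono (Finset.mem_range.1 hi)) le_rfl).const_smul (c i)
    have hmeas : Measurable (fun x : Space d ↦ Complex.exp (⟪x, u⟫_ℝ * Complex.I)) := by fun_prop
    have := h n (c n • u)
      (fun ω ↦ ξ ω * Complex.exp (⟪∑ i ∈ Finset.range n, c i • D i ω, u⟫_ℝ * Complex.I))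
      ((hξ.mono (hmono (Nat.zero_le n)) le_rfl).mul (hmeas.comp hS))
      (fun ω ↦ by rw [norm_mul, Complex.norm_exp_ofReal_mul_I, mul_one]; exact hb ω)
    rw [ih, mul_assoc, ← Complex.exp_add] at this
    convert this using 2
    · ext ω
      beta_reduce
      rw [mul_assoc, ← Complex.exp_add, Finset.sum_range_succ, inner_add_left,
        real_inner_smul_left, real_inner_smul_right]
      push_cast
      ring_nf
    · rw [Finset.sum_range_succ, norm_smul, mul_pow, Real.norm_eq_abs, sq_abs]
      push_cast
      ring_nf

lemma IsGaussianGiven.of_tendsto_ae [IsProbabilityMeasure P] (hm : m ≤ mΩ)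
    {D : ℕ → Ω → Space d} {D' : Ω → Space d} {q : ℕ → ℝ} {q' : ℝ}
    (hD : ∀ n, AEStronglyMeasurable (D n) P) (h : ∀ n, IsGaussianGiven m P (D n) (q n))
    (hlim : ∀ᵐ ω ∂P, Tendsto (fun n ↦ D n ω) atTop (𝓝 (D' ω))) (hq : Tendsto q atTop (𝓝 q')) :
    IsGaussianGiven m P D' q' := by
  intro u ξ hξ hb
  have hξ' := hξ.mono hm le_rfl
  have h1 : Tendsto (fun n ↦ ∫ ω, ξ ω * Complex.exp (⟪D n ω, u⟫_ℝ * Complex.I) ∂P) atTop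
      (𝓝 (∫ ω, ξ ω * Complex.exp (⟪D' ω, u⟫_ℝ * Complex.I) ∂P)) := by
    refine tendsto_integral_of_dominated_convergence (fun _ ↦ 1) (fun n ↦ ?_)
      (integrable_const _) (fun n ↦ ae_of_all _ fun ω ↦ ?_) ?_
    · have : Continuous (fun x : Space d ↦ Complex.exp (⟪x, u⟫_ℝ * Complex.I)) := by fun_prop
      exact hξ'.aestronglyMeasurable.mul (this.comp_aestronglyMeasurable (hD n))
    · rw [norm_mul, Complex.norm_exp_ofReal_mul_I, mul_one]; exact hb ω
    · filter_upwards [hlim] with ω hω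
      have : Continuous (fun x : Space d ↦ ξ ω * Complex.exp (⟪x, u⟫_ℝ * Complex.I)) := by fun_prop
      exact (this.tendsto _).comp hω
  simp_rw [fun n ↦ h n u ξ hξ hb] at h1
  refine tendsto_nhds_unique h1 ?_
  have : Continuous (fun r : ℝ ↦
      (∫ ω, ξ ω ∂P) * Complex.exp (-((r * ‖u‖ ^ 2 / 2 : ℝ) : ℂ))) := by fun_prop
  exact (this.tendsto q').comp hq

lemma IsGaussianGiven.of_tendstoInMeasure [IsProbabilityMeasure P] 
    (hm : m ≤ mΩ) {D : ℕ → Ω → Space d} {D' : Ω → Space d} {q : ℕ → ℝ} {q' : ℝ}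
    (hD : ∀ n, AEStronglyMeasurable (D n) P) (h : ∀ n, IsGaussianGiven m P (D n) (q n))
    (hlim : TendstoInMeasure P D atTop D') (hq : Tendsto q atTop (𝓝 q')) :
    IsGaussianGiven m P D' q' := by
  obtain ⟨ns, hns, hae⟩ := hlim.exists_seq_tendsto_ae
  exact IsGaussianGiven.of_tendsto_ae hm (fun n ↦ hD (ns n)) (fun n ↦ h (ns n)) hae
    (hq.comp hns.tendsto_atTop)

lemma IsGaussianGiven.map_restrict [IsProbabilityMeasure P] (hm : m ≤ mΩ)
    {D : Ω → Space d} {q : ℝ} (hq : 0 ≤ q) (hD : AEMeasurable D P) (h : IsGaussianGiven m P D q)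
    {A : Set Ω} (hA : MeasurableSet[m] A) :
    (P.restrict A).map D = P A • isoGaussian 0 q := by
  have : IsFiniteMeasure (P A • isoGaussian (0 : Space d) q) :=
    Measure.smul_finite _ (measure_ne_top _ _)
  refine Measure.ext_of_charFun ?_
  ext u
  have hA' := hm _ hA
  have h1 := h u (A.indicator 1) ((measurable_const (a := (1 : ℂ))).indicator hA) (fun ω ↦ by
    by_cases hω : ω ∈ A <;> simp [hω])
  rw [charFun_apply, integral_map hD.restrict (by fun_prop), ← integral_indicator hA']
  rw [charFun_apply, integral_smul_measure, ← charFun_apply, charFun_isoGaussian _ hq]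
  convert h1 using 1
  · congr 1 with ω
    by_cases hω : ω ∈ A <;> simp [hω]
  · rw [integral_indicator hA']
    simp [Measure.real, Algebra.smul_def]

lemma IsGaussianGiven.hasLaw [IsProbabilityMeasure P] (hm : m ≤ mΩ)
    {D : Ω → Space d} {q : ℝ} (hq : 0 ≤ q) (hD : AEMeasurable D P) (h : IsGaussianGiven m P D q) :
    HasLaw D (isoGaussian 0 q) P := by
  refine ⟨hD, ?_⟩
  have := h.map_restrict hm hq hD (A := univ) MeasurableSet.univ
  simpa using this

lemma IsGaussianGiven.hasLaw_prod [IsProbabilityMeasure P] (hm : m ≤ mΩ)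
    {D : Ω → Space d} {q : ℝ} (hq : 0 ≤ q) (hD : AEMeasurable D P) (h : IsGaussianGiven m P D q)
    {β : Type*} [MeasurableSpace β] {U : Ω → β} (hU : Measurable[m] U) :
    P.map (fun ω ↦ (U ω, D ω)) = (P.map U).prod (isoGaussian 0 q) := by
  have hU' := hU.mono hm le_rfl
  symm
  refine Measure.prod_eq fun s t hs ht ↦ ?_
  rw [Measure.map_apply_of_aemeasurable (by fun_prop) (hs.prod ht), Measure.map_apply hU' hs,
    ← smul_eq_mul, ← Measure.smul_apply, ← h.map_restrict hm hq hD (hU hs),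
    Measure.map_apply_of_aemeasurable hD.restrict ht, Measure.restrict_apply₀', inter_comm]
  · rfl
  · exact (hU' hs).nullMeasurableSet

end

section

variable {Ω : Type*} {m mΩ : MeasurableSpace Ω} {d : ℕ} {P : Measure Ω}

lemma integral_norm_sq_sum_smul [IsProbabilityMeasure P] (𝓖 : ℕ → MeasurableSpace Ω)
    (hmono : Monotone 𝓖) (hle : ∀ i, 𝓖 i ≤ mΩ)
    (D : ℕ → Ω → Space d) (hD : ∀ i, Measurable[𝓖 (i + 1)] (D i))
    (hind : ∀ i, Indep (MeasurableSpace.comap (D i) inferInstance) (𝓖 i) P)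
    (hmem : ∀ i, MemLp (D i) 2 P) (hmean : ∀ i, ∫ ω, D i ω ∂P = 0)
    (ξ : ℕ → Ω → ℝ) (hξ : ∀ i, Measurable[𝓖 i] (ξ i)) (hb : ∀ i, ∃ C : ℝ, ∀ ω, |ξ i ω| ≤ C)
    (n : ℕ) :
    MemLp (fun ω ↦ ∑ i ∈ Finset.range n, ξ i ω • D i ω) 2 P ∧
    ∫ ω, ‖∑ i ∈ Finset.range n, ξ i ω • D i ω‖ ^ 2 ∂P
      = ∑ i ∈ Finset.range n, (∫ ω, ξ i ω ^ 2 ∂P) * ∫ ω, ‖D i ω‖ ^ 2 ∂P := by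
  have hξ' : ∀ i, Measurable (ξ i) := fun i ↦ (hξ i).mono (hle i) le_rfl
  have hmul : ∀ i (Y : Ω → Space d), MemLp Y 2 P → MemLp (fun ω ↦ ξ i ω • Y ω) 2 P := by
    intro i Y hY
    obtain ⟨C, hC⟩ := hb i
    refine MemLp.of_le_mul (c := C) hY ((hξ' i).aestronglyMeasurable.smul hY.1)
      (ae_of_all _ fun ω ↦ ?_)
    rw [norm_smul]
    exact mul_le_mul_of_nonneg_right (hC ω) (norm_nonneg _)
  induction n with
  | zero => simp
  | succ n ih =>
    obtain ⟨ih1, ih2⟩ := ih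
    set S : Ω → Space d := fun ω ↦ ∑ i ∈ Finset.range n, ξ i ω • D i ω with hSdef
    have hS : Measurable[𝓖 n] S := by
      refine Finset.measurable_fun_sum _ fun i hi ↦ ?_
      have hi := Finset.mem_range.1 hi
      exact ((hξ i).mono (hmono hi.le) le_rfl).smul ((hD i).mono (hmono hi) le_rfl)
    have hsplit : ∀ ω, ∑ i ∈ Finset.range (n + 1), ξ i ω • D i ω = S ω + ξ n ω • D n ω :=
      fun ω ↦ Finset.sum_range_succ _ _
    simp_rw [hsplit]
    have hDn := hmul n _ (hmem n)
    refine ⟨ih1.add hDn, ?_⟩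
    have hcross : ∫ ω, ⟪ξ n ω • S ω, D n ω⟫_ℝ ∂P = 0 := by
      have hi : IndepFun (fun ω ↦ ξ n ω • S ω) (D n) P := by
        rw [IndepFun_iff_Indep]
        exact (indep_of_indep_of_le_right (hind n) ((hξ n).smul hS).comap_le).symm
      have := hi.integral_bilin ((hmul n _ ih1).integrable one_le_two)
        ((hmem n).integrable one_le_two) (innerSL ℝ)
      rw [hmean n, map_zero] at this
      exact this
    have hsq : ∫ ω, ‖ξ n ω • D n ω‖ ^ 2 ∂P = (∫ ω, ξ n ω ^ 2 ∂P) * ∫ ω, ‖D n ω‖ ^ 2 ∂P := by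
      have hi : IndepFun (fun ω ↦ ξ n ω ^ 2) (fun ω ↦ ‖D n ω‖ ^ 2) P := by
        rw [IndepFun_iff_Indep]
        refine (indep_of_indep_of_le_right (indep_of_indep_of_le_left (hind n) ?_)
          ((hξ n).pow_const 2).comap_le).symm
        have : Measurable (fun x : Space d ↦ ‖x‖ ^ 2) := by fun_prop
        exact (this.comp (comap_measurable (D n))).comap_le
      have h' := hi.integral_fun_mul_eq_mul_integral
        ((hξ' n).pow_const 2).aestronglyMeasurable ((hmem n).1.norm.pow 2)
      rw [← h']
      congr 1 with ω
      rw [norm_smul, mul_pow, Real.norm_eq_abs, sq_abs]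
    have hexp : ∀ ω, ‖S ω + ξ n ω • D n ω‖ ^ 2
        = ‖S ω‖ ^ 2 + 2 * ⟪ξ n ω • S ω, D n ω⟫_ℝ + ‖ξ n ω • D n ω‖ ^ 2 := by
      intro ω
      rw [norm_add_sq_real, real_inner_smul_left, real_inner_smul_right]
    have hi1 : Integrable (fun ω ↦ ‖S ω‖ ^ 2) P := ih1.integrable_norm_pow two_ne_zero
    have hi3 : Integrable (fun ω ↦ ‖ξ n ω • D n ω‖ ^ 2) P := hDn.integrable_norm_pow two_ne_zero
    have hi2 : Integrable (fun ω ↦ 2 * ⟪ξ n ω • S ω, D n ω⟫_ℝ) P := by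
      refine ((((ih1.add hDn).integrable_norm_pow two_ne_zero).sub hi1).sub hi3).congr
        (ae_of_all _ fun ω ↦ ?_)
      simp only [Pi.sub_apply, Pi.add_apply, hexp ω]
      ring
    simp_rw [hexp]
    rw [integral_add (by exact hi1.add hi2) hi3, integral_add hi1 hi2, integral_const_mul, hcross, ih2, hsq,
      Finset.sum_range_succ]
    ring

lemma lintegral_enorm_sq_eq_ofReal {E : Type*} [NormedAddCommGroup E] {f : Ω → E}
    (hf : MemLp f 2 P) : ∫⁻ ω, ‖f ω‖ₑ ^ 2 ∂P = ENNReal.ofReal (∫ ω, ‖f ω‖ ^ 2 ∂P) := by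
  rw [ofReal_integral_eq_lintegral_ofReal (hf.integrable_norm_pow two_ne_zero)
    (ae_of_all _ fun _ ↦ by positivity)]
  congr 1 with ω
  rw [ENNReal.ofReal_pow (norm_nonneg _), ofReal_norm]

lemma integral_sub_const_sq [IsProbabilityMeasure P] {Z : Ω → ℝ} (hZ : MemLp Z 2 P) (c : ℝ) :
    ∫ ω, (Z ω - c) ^ 2 ∂P = ∫ ω, (Z ω - ∫ ω', Z ω' ∂P) ^ 2 ∂P + (∫ ω, Z ω ∂P - c) ^ 2 := by
  have h1 : Integrable Z P := hZ.integrable one_le_two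
  have h2 : Integrable (fun ω ↦ Z ω ^ 2) P := hZ.integrable_sq
  have key : ∀ a : ℝ, ∫ ω, (Z ω - a) ^ 2 ∂P = ∫ ω, Z ω ^ 2 ∂P - 2 * a * ∫ ω, Z ω ∂P + a ^ 2 := by
    intro a
    have : ∀ ω, (Z ω - a) ^ 2 = Z ω ^ 2 - 2 * a * Z ω + a ^ 2 := fun ω ↦ by ring
    simp_rw [this]
    rw [integral_add (by exact h2.sub (h1.const_mul _)) (integrable_const _),
      integral_sub h2 (h1.const_mul _), integral_const_mul]
    simp
  rw [key, key]
  ring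

lemma lintegral_enorm_sub_integral_sq_le [IsProbabilityMeasure P] {Z : Ω → ℝ} (hZ : MemLp Z 2 P)
    (c : ℝ) : ∫⁻ ω, ‖Z ω - ∫ ω', Z ω' ∂P‖ₑ ^ 2 ∂P ≤ ∫⁻ ω, ‖Z ω - c‖ₑ ^ 2 ∂P := by
  rw [lintegral_enorm_sq_eq_ofReal (f := fun ω ↦ Z ω - c) (hZ.sub (memLp_const c)),
    lintegral_enorm_sq_eq_ofReal (f := fun ω ↦ Z ω - ∫ ω', Z ω' ∂P) (hZ.sub (memLp_const _))]
  refine ENNReal.ofReal_le_ofReal ?_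
  simp only [Real.norm_eq_abs, sq_abs]
  rw [integral_sub_const_sq hZ c]
  exact le_add_of_nonneg_right (sq_nonneg _)

lemma enorm_integral_sub_sq_le [IsProbabilityMeasure P] {Z : Ω → ℝ} (hZ : MemLp Z 2 P)
    (c : ℝ) : ‖∫ ω, Z ω ∂P - c‖ₑ ^ 2 ≤ ∫⁻ ω, ‖Z ω - c‖ₑ ^ 2 ∂P := by
  rw [lintegral_enorm_sq_eq_ofReal (f := fun ω ↦ Z ω - c) (hZ.sub (memLp_const c)),
    ← ofReal_norm, ← ENNReal.ofReal_pow (norm_nonneg _)]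
  refine ENNReal.ofReal_le_ofReal ?_
  simp only [Real.norm_eq_abs, sq_abs]
  rw [integral_sub_const_sq hZ c]
  exact le_add_of_nonneg_left (integral_nonneg fun _ ↦ sq_nonneg _)

lemma tendsto_eLpNorm_two_of_lintegral {ι E : Type*} [NormedAddCommGroup E] {l : Filter ι}
    {f : ι → Ω → E} (h : Tendsto (fun n ↦ ∫⁻ ω, ‖f n ω‖ₑ ^ 2 ∂P) l (𝓝 0)) :
    Tendsto (fun n ↦ eLpNorm (f n) 2 P) l (𝓝 0) := by
  have h2 : ∀ n, eLpNorm (f n) 2 P = (∫⁻ ω, ‖f n ω‖ₑ ^ 2 ∂P) ^ (1 / 2 : ℝ) := by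
    intro n
    rw [eLpNorm_eq_lintegral_rpow_enorm_toReal (by norm_num) (by norm_num)]
    simp
  simp_rw [h2]
  have := (ENNReal.continuous_rpow_const (y := (1 / 2 : ℝ))).tendsto 0
  rw [ENNReal.zero_rpow_of_pos (by norm_num)] at this
  exact this.comp h

lemma tendsto_integral_sq_of_tendsto_eLpNorm {φ : ℕ → Ω → ℝ} {g : Ω → ℝ}
    (hφ : ∀ n, MemLp (φ n) 2 P) (hg : MemLp g 2 P)
    (h : Tendsto (fun n ↦ eLpNorm (φ n - g) 2 P) atTop (𝓝 0)) :
    Tendsto (fun n ↦ ∫ x, φ n x ^ 2 ∂P) atTop (𝓝 (∫ x, g x ^ 2 ∂P)) := by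
  have key : ∀ {u : Ω → ℝ} (hu : MemLp u 2 P), ∫ x, u x ^ 2 ∂P = ‖hu.toLp u‖ ^ 2 := by
    intro u hu
    rw [← real_inner_self_eq_norm_sq, L2.inner_def]
    refine integral_congr_ae ?_
    filter_upwards [hu.coeFn_toLp] with x hx
    simp [hx, sq]
  simp_rw [key (hφ _), key hg]
  have : Tendsto (fun n ↦ (hφ n).toLp (φ n)) atTop (𝓝 (hg.toLp g)) :=
    (Lp.tendsto_Lp_iff_tendsto_eLpNorm'' φ hφ g hg).2 h
  exact this.norm.pow 2

end

section

variable {Ω : Type*} {m mΩ : MeasurableSpace Ω} {d : ℕ} {P : Measure Ω}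
  {𝓕 : Filtration ℝ mΩ} {T : ℝ} {W : ℝ → Ω → Space d}

lemma IsGaussianGiven.mono {m' : MeasurableSpace Ω} (hm : m' ≤ m) {D : Ω → Space d} {q : ℝ}
    (h : IsGaussianGiven m P D q) : IsGaussianGiven m' P D q :=
  fun u ξ hξ hb ↦ h u ξ (hξ.mono hm le_rfl) hb

namespace IsWienerProcess

lemma measurable (hW : IsWienerProcess 𝓕 P T W) {t : ℝ} (ht : t ∈ Icc 0 T) : Measurable (W t) :=
  (hW.adapted t ht).mono (𝓕.le t) le_rfl

lemma measurable_sub (hW : IsWienerProcess 𝓕 P T W) {s t r : ℝ} (hs : s ∈ Icc 0 T)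
    (ht : t ∈ Icc 0 T) (hsr : s ≤ r) (htr : t ≤ r) :
    Measurable[𝓕 r] (fun ω ↦ W t ω - W s ω) :=
  ((hW.adapted t ht).mono (𝓕.mono htr) le_rfl).sub ((hW.adapted s hs).mono (𝓕.mono hsr) le_rfl)

lemma isGaussianGiven (hW : IsWienerProcess 𝓕 P T W) {s t : ℝ} (hs : s ∈ Icc 0 T)
    (ht : t ∈ Icc s T) : IsGaussianGiven (𝓕 s) P (fun ω ↦ W t ω - W s ω) (t - s) :=
  isGaussianGiven_of_indep (𝓕.le s) (sub_nonneg.2 ht.1)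
    ((hW.measurable ⟨hs.1.trans ht.1, ht.2⟩).sub (hW.measurable hs)) (hW.indep s hs t ht)
    (hW.law s hs t ht)

lemma memLp_sub (hW : IsWienerProcess 𝓕 P T W) {s t : ℝ} (hs : s ∈ Icc 0 T)
    (ht : t ∈ Icc s T) : MemLp (fun ω ↦ W t ω - W s ω) 2 P := by
  have hl := hW.law s hs t ht
  have : MemLp id 2 (P.map (fun ω ↦ W t ω - W s ω)) := by
    rw [hl.map_eq]; exact IsGaussian.memLp_two_id
  exact this.comp_of_map hl.aemeasurable

lemma integral_sub_eq_zero (hW : IsWienerProcess 𝓕 P T W) {s t : ℝ} (hs : s ∈ Icc 0 T)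
    (ht : t ∈ Icc s T) : ∫ ω, (W t ω - W s ω) ∂P = 0 := by
  rw [(hW.law s hs t ht).integral_eq]
  exact integral_id_multivariateGaussian

lemma integral_norm_sub_sq {C : ℝ}
    (hC : ∀ v, 0 ≤ v → ∫ x, ‖x‖ ^ 2 ∂(isoGaussian (0 : Space d) v) = C * v)
    (hW : IsWienerProcess 𝓕 P T W) {s t : ℝ} (hs : s ∈ Icc 0 T)
    (ht : t ∈ Icc s T) : ∫ ω, ‖W t ω - W s ω‖ ^ 2 ∂P = C * (t - s) := by
  have hl := hW.law s hs t ht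
  rw [← hC _ (sub_nonneg.2 ht.1), ← hl.integral_comp (f := fun x ↦ ‖x‖ ^ 2)
    (Measurable.aestronglyMeasurable (by fun_prop))]
  rfl

end IsWienerProcess

namespace ElementaryProcess

lemma zero_le_time (V : ElementaryProcess 𝓕) (i : ℕ) : 0 ≤ V.time i :=
  V.time_nonneg.trans (V.time_mono (Nat.zero_le i))

lemma comp_value {β : Type*} [AddCommMonoid β] (V : ElementaryProcess 𝓕) (F : ℝ → β) (hF : F 0 = 0)
    (t : ℝ) (ω : Ω) :
    F (V.value t ω) = ∑ i ∈ Finset.range V.n,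
      (Ioc (V.time i) (V.time (i + 1))).indicator (fun _ ↦ F (V.coeff i ω)) t := by
  by_cases h : ∃ i ∈ Finset.range V.n, t ∈ Ioc (V.time i) (V.time (i + 1))
  · obtain ⟨i, hi, hti⟩ := h
    have hne : ∀ j, j ≠ i → t ∉ Ioc (V.time j) (V.time (j + 1)) := by
      intro j hj htj
      rcases lt_or_gt_of_ne hj with hlt | hlt
      · have := V.time_mono (Nat.succ_le_of_lt hlt)
        exact absurd (hti.1.trans_le (htj.2.trans this)) (lt_irrefl _)
      · have := V.time_mono (Nat.succ_le_of_lt hlt)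
        exact absurd (htj.1.trans_le (hti.2.trans this)) (lt_irrefl _)
    rw [value, Finset.sum_eq_single_of_mem i hi (fun j _ hj ↦ indicator_of_notMem (hne j hj) _),
      Finset.sum_eq_single_of_mem i hi (fun j _ hj ↦ indicator_of_notMem (hne j hj) _),
      indicator_of_mem hti, indicator_of_mem hti]
  · push Not at h
    rw [value, Finset.sum_eq_zero (fun i hi ↦ indicator_of_notMem (h i hi) _),
      Finset.sum_eq_zero (fun i hi ↦ indicator_of_notMem (h i hi) _), hF]

lemma measurable_coeff (V : ElementaryProcess 𝓕) (i : ℕ) : Measurable (V.coeff i) :=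
  (V.coeff_measurable i).mono (𝓕.le _) le_rfl

lemma memLp_coeff [IsProbabilityMeasure P] (V : ElementaryProcess 𝓕) (i : ℕ) (p : ℝ≥0∞) :
    MemLp (V.coeff i) p P := by
  obtain ⟨C, hC⟩ := V.coeff_bounded i
  exact MemLp.of_bound (V.measurable_coeff i).aestronglyMeasurable C (ae_of_all _ hC)

lemma measurable_uncurry_value (V : ElementaryProcess 𝓕) :
    Measurable (fun p : Ω × ℝ ↦ V.value p.2 p.1) := by
  refine Finset.measurable_fun_sum _ fun i _ ↦ ?_
  exact ((V.measurable_coeff i).comp measurable_fst).indicator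
    (measurable_snd (measurableSet_Ioc (a := V.time i) (b := V.time (i + 1))))

lemma memLp_value [IsProbabilityMeasure P] (V : ElementaryProcess 𝓕) (t : ℝ) (p : ℝ≥0∞) :
    MemLp (V.value t) p P := by
  refine memLp_finsetSum _ fun i _ ↦ ?_
  by_cases h : t ∈ Ioc (V.time i) (V.time (i + 1))
  · simpa [h] using V.memLp_coeff i p
  · simp [h]

lemma measurable_integral (hW : IsWienerProcess 𝓕 P T W) (V : ElementaryProcess 𝓕) {t : ℝ}
    (ht : t ∈ Icc 0 T) : Measurable (V.integral W t) := by
  have h : ∀ i, min (V.time i) t ∈ Icc 0 T := fun i ↦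
    ⟨le_min (V.zero_le_time i) ht.1, (min_le_right _ _).trans ht.2⟩
  exact Finset.measurable_fun_sum _ fun i _ ↦
    (V.measurable_coeff i).smul ((hW.measurable (h _)).sub (hW.measurable (h _)))

/-- The mean `E V_t` of an elementary integrand, as a deterministic elementary integrand. -/
noncomputable def mean (V : ElementaryProcess 𝓕) (P : Measure Ω) : ElementaryProcess 𝓕 where
  n := V.n
  time := V.time
  coeff i _ := ∫ ω, V.coeff i ω ∂P
  time_nonneg := V.time_nonneg
  time_mono := V.time_mono
  coeff_measurable _ := measurable_const
  coeff_bounded _ := ⟨_, fun _ ↦ le_rfl⟩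

/-- The fluctuation `V_t - E V_t` of an elementary integrand. -/
noncomputable def centered (V : ElementaryProcess 𝓕) (P : Measure Ω) : ElementaryProcess 𝓕 where
  n := V.n
  time := V.time
  coeff i ω := V.coeff i ω - ∫ ω, V.coeff i ω ∂P
  time_nonneg := V.time_nonneg
  time_mono := V.time_mono
  coeff_measurable i := (V.coeff_measurable i).sub_const _
  coeff_bounded i := by
    obtain ⟨C, hC⟩ := V.coeff_bounded i
    exact ⟨C + |∫ ω, V.coeff i ω ∂P|, fun ω ↦ (abs_sub _ _).trans (add_le_add_left (hC ω) _)⟩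

lemma mean_value [IsProbabilityMeasure P] (V : ElementaryProcess 𝓕) (t : ℝ) (ω : Ω) :
    (V.mean P).value t ω = ∫ ω, V.value t ω ∂P := by
  have hint : ∀ i ∈ Finset.range V.n, Integrable (fun ω ↦
      (Ioc (V.time i) (V.time (i + 1))).indicator (fun _ ↦ V.coeff i ω) t) P := by
    intro i _
    by_cases h : t ∈ Ioc (V.time i) (V.time (i + 1))
    · simpa [h] using (V.memLp_coeff (P := P) i 1).integrable le_rfl
    · simp [h]
  simp only [value]
  rw [integral_finsetSum _ hint]
  refine Finset.sum_congr rfl fun i _ ↦ ?_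
  by_cases h : t ∈ Ioc (V.time i) (V.time (i + 1)) <;> simp [h, mean]

lemma centered_value (V : ElementaryProcess 𝓕) (t : ℝ) (ω : Ω) :
    (V.centered P).value t ω = V.value t ω - (V.mean P).value t ω := by
  simp only [value, mean, centered]
  rw [← Finset.sum_sub_distrib]
  refine Finset.sum_congr rfl fun i _ ↦ ?_
  by_cases h : t ∈ Ioc (V.time i) (V.time (i + 1)) <;> simp [h]

lemma mean_integral (V : ElementaryProcess 𝓕) (t : ℝ) (ω : Ω) :
    (V.mean P).integral W t ω = V.integral W t ω - (V.centered P).integral W t ω := by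
  simp only [integral, mean, centered]
  rw [← Finset.sum_sub_distrib]
  refine Finset.sum_congr rfl fun i _ ↦ ?_
  rw [← sub_smul, sub_sub_cancel]

lemma lintegral_integral_sq_le [IsProbabilityMeasure P] {C : ℝ} (hC0 : 0 ≤ C)
    (hC : ∀ v, 0 ≤ v → ∫ x, ‖x‖ ^ 2 ∂(isoGaussian (0 : Space d) v) = C * v)
    (hW : IsWienerProcess 𝓕 P T W) (V : ElementaryProcess 𝓕) {t : ℝ} (ht : t ∈ Icc 0 T) :
    ∫⁻ ω, ‖V.integral W t ω‖ₑ ^ 2 ∂P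
      ≤ ENNReal.ofReal C * ∫⁻ s in Icc 0 T, ∫⁻ ω, ‖V.value s ω‖ₑ ^ 2 ∂P := by
  set r : ℕ → ℝ := fun i ↦ min (V.time i) t with hr
  have hrmono : Monotone r := fun i j hij ↦ min_le_min_right _ (V.time_mono hij)
  have hrT : ∀ i, r i ∈ Icc 0 T := fun i ↦
    ⟨le_min (V.zero_le_time i) ht.1, (min_le_right _ _).trans ht.2⟩
  have hrr : ∀ i, r (i + 1) ∈ Icc (r i) T := fun i ↦ ⟨hrmono i.le_succ, (hrT _).2⟩
  set ξ : ℕ → Ω → ℝ := fun i ω ↦ if V.time i ≤ t then V.coeff i ω else 0 with hξ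
  have hint : ∀ ω, V.integral W t ω
      = ∑ i ∈ Finset.range V.n, ξ i ω • (W (r (i + 1)) ω - W (r i) ω) := by
    intro ω
    refine Finset.sum_congr rfl fun i _ ↦ ?_
    by_cases h : V.time i ≤ t
    · simp [hξ, h, hr]
    · have h2 : t ≤ V.time (i + 1) := (not_le.1 h).le.trans (V.time_mono i.le_succ)
      simp [h, ξ, (not_le.1 h).le, h2]
  obtain ⟨hmem, heq⟩ := integral_norm_sq_sum_smul (fun i ↦ 𝓕 (r i))
    (fun i j hij ↦ 𝓕.mono (hrmono hij)) (fun i ↦ 𝓕.le _)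
    (fun i ω ↦ W (r (i + 1)) ω - W (r i) ω)
    (fun i ↦ hW.measurable_sub (hrT _) (hrT _) (hrmono i.le_succ) le_rfl)
    (fun i ↦ hW.indep _ (hrT i) _ (hrr i)) (fun i ↦ hW.memLp_sub (hrT i) (hrr i))
    (fun i ↦ hW.integral_sub_eq_zero (hrT i) (hrr i)) ξ
    (fun i ↦ by
      by_cases h : V.time i ≤ t
      · have : r i = V.time i := min_eq_left h
        simp only [hξ, h, if_true]
        rw [this]
        exact V.coeff_measurable i
      · simp only [hξ, h, if_false]
        exact measurable_const)
    (fun i ↦ by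
      obtain ⟨K, hK⟩ := V.coeff_bounded i
      refine ⟨K, fun ω ↦ ?_⟩
      by_cases h : V.time i ≤ t
      · simpa [hξ, h] using hK ω
      · simpa [hξ, h] using (abs_nonneg _).trans (hK ω)) V.n
  simp_rw [hint]
  rw [lintegral_enorm_sq_eq_ofReal hmem, heq]
  have hval : ∀ s ω, ‖V.value s ω‖ₑ ^ 2 = ∑ i ∈ Finset.range V.n,
      (Ioc (V.time i) (V.time (i + 1))).indicator (fun _ ↦ ‖V.coeff i ω‖ₑ ^ 2) s :=
    fun s ω ↦ V.comp_value (fun x ↦ ‖x‖ₑ ^ 2) (by simp) s ω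
  have hval2 : ∀ s, ∫⁻ ω, ‖V.value s ω‖ₑ ^ 2 ∂P = ∑ i ∈ Finset.range V.n,
      (Ioc (V.time i) (V.time (i + 1))).indicator
        (fun _ ↦ ∫⁻ ω, ‖V.coeff i ω‖ₑ ^ 2 ∂P) s := by
    intro s
    simp_rw [hval]
    rw [lintegral_finsetSum]
    · refine Finset.sum_congr rfl fun i _ ↦ ?_
      by_cases h : s ∈ Ioc (V.time i) (V.time (i + 1)) <;> simp [h]
    · intro i _
      have := V.measurable_coeff i
      by_cases h : s ∈ Ioc (V.time i) (V.time (i + 1))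
      · simp only [h, indicator_of_mem]; fun_prop
      · simp [h]
  simp_rw [hval2]
  rw [lintegral_finsetSum _ (fun i _ ↦ measurable_const.indicator measurableSet_Ioc),
    ENNReal.ofReal_sum_of_nonneg, Finset.mul_sum]
  · refine Finset.sum_le_sum fun i _ ↦ ?_
    rw [lintegral_indicator measurableSet_Ioc, lintegral_const,
      hW.integral_norm_sub_sq hC (hrT i) (hrr i), mul_left_comm,
      ENNReal.ofReal_mul hC0, Measure.restrict_restrict measurableSet_Ioc, Measure.restrict_apply
        MeasurableSet.univ, univ_inter, lintegral_enorm_sq_eq_ofReal (V.memLp_coeff i 2),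
      ENNReal.ofReal_mul (integral_nonneg fun _ ↦ sq_nonneg _)]
    gcongr ENNReal.ofReal C * (ENNReal.ofReal ?_ * ?_)
    · by_cases h : V.time i ≤ t
      · simp [hξ, h]
      · simp only [hξ, h, if_false]
        simp only [ne_eq, OfNat.ofNat_ne_zero, not_false_eq_true, zero_pow, integral_zero]
        positivity
    · rw [← Real.volume_Ioc]
      refine measure_mono fun x hx ↦ ?_
      have h1 : V.time i < x := by
        rcases min_lt_iff.1 hx.1 with h | h
        · exact h
        · exact absurd (hx.2.trans (min_le_right _ _)) (not_le.2 h)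
      exact ⟨⟨h1, hx.2.trans (min_le_left _ _)⟩, (V.zero_le_time i).trans h1.le,
        hx.2.trans (hrT _).2⟩
  · intro i _
    rw [hW.integral_norm_sub_sq hC (hrT i) (hrr i)]
    have := sub_nonneg.2 (hrr i).1
    exact mul_nonneg (integral_nonneg fun _ ↦ sq_nonneg _) (by positivity)

lemma integral_value_sq {s t : ℝ} (hst : s ≤ t) (V : ElementaryProcess 𝓕) (ω : Ω) :
    ∫ r in s..t, V.value r ω ^ 2 = ∑ i ∈ Finset.range V.n, V.coeff i ω ^ 2 *
      (min (max (V.time (i + 1)) s) t - min (max (V.time i) s) t) := by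
  have hval : ∀ r, V.value r ω ^ 2 = ∑ i ∈ Finset.range V.n,
      (Ioc (V.time i) (V.time (i + 1))).indicator (fun _ ↦ V.coeff i ω ^ 2) r :=
    fun r ↦ V.comp_value (fun x ↦ x ^ 2) (by simp) r ω
  simp_rw [hval]
  rw [intervalIntegral.integral_of_le hst, integral_finsetSum]
  · refine Finset.sum_congr rfl fun i _ ↦ ?_
    rw [integral_indicator measurableSet_Ioc, setIntegral_const, smul_eq_mul, mul_comm,
      Measure.real, Measure.restrict_apply' measurableSet_Ioc, Ioc_inter_Ioc, Real.volume_Ioc]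
    congr 1
    have h := V.time_mono i.le_succ
    generalize V.time i = a at h ⊢
    generalize V.time (i + 1) = b at h ⊢
    rw [ENNReal.toReal_ofReal']
    grind
  · intro i _
    exact (integrable_const _).indicator measurableSet_Ioc

lemma isGaussianGiven_mean_integral_sub [IsProbabilityMeasure P]
    (hW : IsWienerProcess 𝓕 P T W) (V : ElementaryProcess 𝓕) {s t : ℝ} (hs : s ∈ Icc 0 T)
    (ht : t ∈ Icc s T) :
    IsGaussianGiven (𝓕 s) P
      (fun ω ↦ (V.mean P).integral W t ω - (V.mean P).integral W s ω)
      (∫ r in s..t, (∫ ω, V.value r ω ∂P) ^ 2) := by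
  obtain ⟨ω₀⟩ : Nonempty Ω := nonempty_of_isProbabilityMeasure P
  set r : ℕ → ℝ := fun i ↦ min (max (V.time i) s) t with hr
  have hrmono : Monotone r := fun i j hij ↦
    min_le_min_right _ (max_le_max_right _ (V.time_mono hij))
  have hsr : ∀ i, s ≤ r i := fun i ↦ le_min (le_max_right _ _) ht.1
  have hrT : ∀ i, r i ∈ Icc 0 T := fun i ↦ ⟨hs.1.trans (hsr i), (min_le_right _ _).trans ht.2⟩
  have hrr : ∀ i, r (i + 1) ∈ Icc (r i) T := fun i ↦ ⟨hrmono i.le_succ, (hrT _).2⟩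
  have h := (IsGaussianGiven.sum (fun i ↦ 𝓕 (r i)) (fun i j hij ↦ 𝓕.mono (hrmono hij))
    (fun i ω ↦ W (r (i + 1)) ω - W (r i) ω) (fun i ↦ r (i + 1) - r i)
    (fun i ↦ ∫ ω, V.coeff i ω ∂P)
    (fun i ↦ hW.measurable_sub (hrT _) (hrT _) (hrmono i.le_succ) le_rfl)
    (fun i ↦ hW.isGaussianGiven (hrT i) (hrr i)) V.n).mono (𝓕.mono (hsr 0))
  have hq := (V.mean P).integral_value_sq ht.1 ω₀
  simp_rw [mean_value] at hq
  rw [hq]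
  change IsGaussianGiven _ _ _
    (∑ i ∈ Finset.range V.n, (∫ ω, V.coeff i ω ∂P) ^ 2 * (r (i + 1) - r i))
  convert h using 2 with ω
  have hclip : ∀ i, W (min (V.time i) t) ω - W (min (V.time i) s) ω = W (r i) ω - W s ω := by
    intro i
    rcases le_total (V.time i) s with h1 | h1
    · simp [hr, h1, h1.trans ht.1, ht.1]
    · simp [hr, h1]
  simp only [integral, mean]
  rw [← Finset.sum_sub_distrib]
  refine Finset.sum_congr rfl fun i _ ↦ ?_
  rw [← smul_sub, sub_sub_sub_comm, hclip, hclip, sub_sub_sub_cancel_right]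

lemma measurable_mean_integral (hW : IsWienerProcess 𝓕 P T W) (V : ElementaryProcess 𝓕) {t : ℝ}
    (ht : t ∈ Icc 0 T) : Measurable[𝓕 t] ((V.mean P).integral W t) := by
  have h : ∀ i, min (V.time i) t ∈ Icc 0 T := fun i ↦
    ⟨le_min (V.zero_le_time i) ht.1, (min_le_right _ _).trans ht.2⟩
  exact Finset.measurable_fun_sum _ fun i _ ↦ Measurable.const_smul
    (hW.measurable_sub (h i) (h (i + 1)) (min_le_right _ _) (min_le_right _ _))
    (∫ ω, V.coeff i ω ∂P)

end ElementaryProcess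

end

section

variable {Ω : Type*} {mΩ : MeasurableSpace Ω} {d : ℕ} {P : Measure Ω}
  {𝓕 : Filtration ℝ mΩ} {T : ℝ} {W : ℝ → Ω → Space d}

lemma ElementaryProcess.lintegral_value_sub_swap [IsProbabilityMeasure P]
    (V : ElementaryProcess 𝓕) {g : ℝ → ℝ} (hg : AEMeasurable g (volume.restrict (Icc 0 T))) :
    ∫⁻ ω, ∫⁻ s in Icc 0 T, ‖V.value s ω - g s‖ₑ ^ 2 ∂volume ∂P
      = ∫⁻ s in Icc 0 T, ∫⁻ ω, ‖V.value s ω - g s‖ₑ ^ 2 ∂P := by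
  refine lintegral_lintegral_swap ?_
  exact ((V.measurable_uncurry_value.aemeasurable.sub hg.comp_snd).enorm).pow_const 2

lemma IsItoIntegral.exists_mean_approx [IsProbabilityMeasure P] (hW : IsWienerProcess 𝓕 P T W)
    {g : ℝ → ℝ} (hg : AEMeasurable g (volume.restrict (Icc 0 T)))
    {K : ℝ} (hK : ∀ s ∈ Icc 0 T, |g s| ≤ K) {M : ℝ → Ω → Space d}
    (hM : IsItoIntegral 𝓕 P T W (fun s _ ↦ g s) M) :
    ∃ V : ℕ → ElementaryProcess 𝓕,
      (∀ t ∈ Icc 0 T, Tendsto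
        (fun n ↦ eLpNorm (((V n).mean P).integral W t - M t) 2 P) atTop (𝓝 0)) ∧
      ∀ s ∈ Icc 0 T, ∀ t ∈ Icc s T, Tendsto
        (fun n ↦ ∫ r in s..t, (∫ ω, (V n).value r ω ∂P) ^ 2) atTop (𝓝 (∫ r in s..t, g r ^ 2)) := by
  obtain ⟨hMmeas, V, hV, hVM⟩ := hM
  simp_rw [fun n ↦ (V n).lintegral_value_sub_swap (P := P) hg] at hV
  refine ⟨V, fun t ht ↦ ?_, fun s hs t ht ↦ ?_⟩
  · obtain ⟨C, hC0, hC⟩ := exists_integral_norm_sq_isoGaussian d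
    have hcent : Tendsto (fun n ↦ ∫⁻ ω, ‖((V n).centered P).integral W t ω‖ₑ ^ 2 ∂P) atTop
        (𝓝 0) := by
      have h0 := ENNReal.Tendsto.const_mul hV (Or.inr (ENNReal.ofReal_ne_top (r := C)))
      rw [mul_zero] at h0
      refine tendsto_of_tendsto_of_tendsto_of_le_of_le tendsto_const_nhds h0
        (fun _ ↦ zero_le) fun n ↦ ?_
      refine (((V n).centered P).lintegral_integral_sq_le hC0 hC hW ht).trans ?_
      refine mul_le_mul_right (lintegral_mono fun s ↦ ?_) _
      simp_rw [ElementaryProcess.centered_value, ElementaryProcess.mean_value]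
      exact lintegral_enorm_sub_integral_sq_le (P := P) ((V n).memLp_value s 2) (g s)
    have h1 := tendsto_eLpNorm_two_of_lintegral hcent
    have h2 := tendsto_eLpNorm_two_of_lintegral (hVM t ht)
    have h3 := h2.add h1
    rw [add_zero] at h3
    refine tendsto_of_tendsto_of_tendsto_of_le_of_le tendsto_const_nhds h3
      (fun _ ↦ zero_le) fun n ↦ ?_
    have hmV := ((V n).measurable_integral hW ht).aestronglyMeasurable (μ := P)
    have hmC := (((V n).centered P).measurable_integral hW ht).aestronglyMeasurable (μ := P)
    refine le_trans (le_of_eq ?_) (eLpNorm_sub_le (hmV.sub (hMmeas t ht)) hmC one_le_two)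
    congr 1
    ext1 ω
    simp only [Pi.sub_apply, ElementaryProcess.mean_integral]
    abel
  · have hsub : Ioc s t ⊆ Icc 0 T := fun x hx ↦ ⟨hs.1.trans hx.1.le, hx.2.trans ht.2⟩
    have hle : volume.restrict (Ioc s t) ≤ volume.restrict (Icc 0 T) :=
      Measure.restrict_mono hsub le_rfl
    simp_rw [intervalIntegral.integral_of_le ht.1]
    have hm : ∀ n, AEStronglyMeasurable (fun r ↦ ∫ ω, (V n).value r ω ∂P) volume := fun n ↦
      ((V n).measurable_uncurry_value.comp measurable_swap).stronglyMeasurable.integral_prod_right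
        |>.aestronglyMeasurable
    have hbdd : ∀ n, ∃ B, ∀ r, |∫ ω, (V n).value r ω ∂P| ≤ B := by
      intro n
      obtain ⟨ω₀⟩ : Nonempty Ω := nonempty_of_isProbabilityMeasure P
      refine ⟨∑ i ∈ Finset.range (V n).n, |∫ ω, (V n).coeff i ω ∂P|, fun r ↦ ?_⟩
      rw [← (V n).mean_value r ω₀]
      refine (Finset.abs_sum_le_sum_abs _ _).trans (Finset.sum_le_sum fun i _ ↦ ?_)
      by_cases h : r ∈ Ioc ((V n).time i) ((V n).time (i + 1)) <;>
        simp [h, ElementaryProcess.mean]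
    refine tendsto_integral_sq_of_tendsto_eLpNorm (fun n ↦ ?_) ?_ ?_
    · obtain ⟨B, hB⟩ := hbdd n
      exact MemLp.of_bound (hm n).restrict B (ae_of_all _ hB)
    · refine MemLp.of_bound (hg.mono_measure hle).aestronglyMeasurable K ?_
      filter_upwards [ae_restrict_mem measurableSet_Ioc] with x hx using hK x (hsub hx)
    · refine tendsto_eLpNorm_two_of_lintegral ?_
      refine tendsto_of_tendsto_of_tendsto_of_le_of_le tendsto_const_nhds hV
        (fun _ ↦ zero_le) fun n ↦ ?_
      refine (lintegral_mono' hle le_rfl).trans (lintegral_mono fun r ↦ ?_)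
      exact enorm_integral_sub_sq_le ((V n).memLp_value r 2) (g r)

lemma IsItoIntegral.isGaussianGiven_sum [IsProbabilityMeasure P] (hW : IsWienerProcess 𝓕 P T W)
    {g : ℝ → ℝ} (hg : AEMeasurable g (volume.restrict (Icc 0 T)))
    {K : ℝ} (hK : ∀ s ∈ Icc 0 T, |g s| ≤ K) {M : ℝ → Ω → Space d}
    (hM : IsItoIntegral 𝓕 P T W (fun s _ ↦ g s) M)
    {r : ℕ → ℝ} (hr : Monotone r) (hrT : ∀ i, r i ∈ Icc 0 T) (c : ℕ → ℝ) (N : ℕ) :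
    IsGaussianGiven (𝓕 (r 0)) P
      (fun ω ↦ ∑ i ∈ Finset.range N, c i • (M (r (i + 1)) ω - M (r i) ω))
      (∑ i ∈ Finset.range N, c i ^ 2 * ∫ s in r i..r (i + 1), g s ^ 2) := by
  obtain ⟨V, hV, hVq⟩ := hM.exists_mean_approx hW hg hK
  have hrr : ∀ i, r (i + 1) ∈ Icc (r i) T := fun i ↦ ⟨hr i.le_succ, (hrT _).2⟩
  set D : ℕ → ℕ → Ω → Space d := fun n i ↦
    ((V n).mean P).integral W (r (i + 1)) - ((V n).mean P).integral W (r i)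
  have hDmeas : ∀ n i, Measurable[𝓕 (r (i + 1))] (D n i) := fun n i ↦
    ((V n).measurable_mean_integral hW (hrT _)).sub
      (((V n).measurable_mean_integral hW (hrT _)).mono (𝓕.mono (hr i.le_succ)) le_rfl)
  have hDmeas' : ∀ n i, AEStronglyMeasurable (D n i) P := fun n i ↦
    ((hDmeas n i).mono (𝓕.le _) le_rfl).aestronglyMeasurable
  have hMmeas : ∀ i, AEStronglyMeasurable (M (r (i + 1)) - M (r i)) P := fun i ↦
    (hM.1 _ (hrT _)).sub (hM.1 _ (hrT _))
  refine IsGaussianGiven.of_tendstoInMeasure (𝓕.le _)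
    (D := fun n ω ↦ ∑ i ∈ Finset.range N, c i • D n i ω)
    (q := fun n ↦ ∑ i ∈ Finset.range N, c i ^ 2 *
      ∫ s in r i..r (i + 1), (∫ ω, (V n).value s ω ∂P) ^ 2)
    (fun n ↦ Finset.aestronglyMeasurable_fun_sum _ fun i _ ↦ (hDmeas' n i).const_smul (c i))
    (fun n ↦ IsGaussianGiven.sum (fun i ↦ 𝓕 (r i)) (fun i j hij ↦ 𝓕.mono (hr hij)) (D n) _ c
      (hDmeas n)
      (fun i ↦ (V n).isGaussianGiven_mean_integral_sub hW (hrT i) (hrr i)) N) ?_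
    (tendsto_finsetSum _ fun i _ ↦ (hVq _ (hrT i) _ (hrr i)).const_mul _)
  refine tendstoInMeasure_of_tendsto_eLpNorm (p := 2) two_ne_zero
    (fun n ↦ Finset.aestronglyMeasurable_fun_sum _ fun i _ ↦ (hDmeas' n i).const_smul (c i))
    (Finset.aestronglyMeasurable_fun_sum _ fun i _ ↦ (hMmeas i).const_smul (c i)) ?_
  have hlim : Tendsto (fun n ↦ ∑ i ∈ Finset.range N, ‖c i‖ₑ *
      (eLpNorm (((V n).mean P).integral W (r (i + 1)) - M (r (i + 1))) 2 P
        + eLpNorm (((V n).mean P).integral W (r i) - M (r i)) 2 P)) atTop (𝓝 0) := by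
    have := tendsto_finsetSum (Finset.range N) fun i _ ↦ ENNReal.Tendsto.const_mul
      ((hV _ (hrT (i + 1))).add (hV _ (hrT i))) (Or.inr (enorm_ne_top (x := c i)))
    simpa using this
  refine tendsto_of_tendsto_of_tendsto_of_le_of_le tendsto_const_nhds hlim
    (fun _ ↦ zero_le) fun n ↦ ?_
  have hmI : ∀ i, AEStronglyMeasurable (((V n).mean P).integral W (r i) - M (r i)) P := fun i ↦
    (((V n).mean P).measurable_integral hW (hrT i)).aestronglyMeasurable.sub (hM.1 _ (hrT i))
  have heq : (fun ω ↦ ∑ i ∈ Finset.range N, c i • D n i ω)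
        - (fun ω ↦ ∑ i ∈ Finset.range N, c i • (M (r (i + 1)) ω - M (r i) ω))
      = ∑ i ∈ Finset.range N, c i • ((((V n).mean P).integral W (r (i + 1)) - M (r (i + 1)))
          - (((V n).mean P).integral W (r i) - M (r i))) := by
    ext1 ω
    simp only [D, Pi.sub_apply, Finset.sum_apply, Pi.smul_apply]
    rw [← Finset.sum_sub_distrib]
    refine Finset.sum_congr rfl fun i _ ↦ ?_
    rw [← smul_sub]
    congr 1
    abel
  rw [heq]
  refine (eLpNorm_sum_le (fun i _ ↦ ((hmI _).sub (hmI _)).const_smul _) one_le_two).trans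
    (Finset.sum_le_sum fun i _ ↦ ?_)
  rw [eLpNorm_const_smul]
  gcongr
  exact eLpNorm_sub_le (hmI _) (hmI _) one_le_two

end

section

variable {E : Type*} [NormedAddCommGroup E]

/-- The `i`-th point of the partition of `[0, t]` into `N + 1` equal parts, constant from
`i = N + 1` on. -/
noncomputable def gridPoint (t : ℝ) (N i : ℕ) : ℝ := min (i * (t / (N + 1))) t

lemma monotone_gridPoint {t : ℝ} (ht : 0 ≤ t) (N : ℕ) : Monotone (gridPoint t N) := by
  intro i j hij
  unfold gridPoint
  gcongr

lemma gridPoint_mem {t : ℝ} (ht : 0 ≤ t) (N i : ℕ) : gridPoint t N i ∈ Icc 0 t :=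
  ⟨le_min (by positivity) ht, min_le_right _ _⟩

lemma gridPoint_zero {t : ℝ} (ht : 0 ≤ t) (N : ℕ) : gridPoint t N 0 = 0 := by
  simp [gridPoint, ht]

lemma gridPoint_last (t : ℝ) (N : ℕ) : gridPoint t N (N + 1) = t := by
  have : ((N : ℝ) + 1) ≠ 0 := by positivity
  simp [gridPoint, mul_div_cancel₀ _ this]

lemma gridPoint_succ_sub_le {t : ℝ} (ht : 0 ≤ t) (N i : ℕ) :
    gridPoint t N (i + 1) - gridPoint t N i ≤ t / (N + 1) := by
  have : 0 ≤ t / ((N : ℝ) + 1) := by positivity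
  unfold gridPoint
  push_cast
  rcases min_cases ((i : ℝ) * (t / (N + 1))) t with h | h
  · rw [h.1]
    have := min_le_left (((i : ℝ) + 1) * (t / (N + 1))) t
    linarith
  · rw [h.1]
    have := min_le_right (((i : ℝ) + 1) * (t / (N + 1))) t
    linarith

lemma tendsto_sum_gridPoint {F : ℝ → E} {Φ : ℝ → ℝ → E} {t : ℝ} (ht : 0 ≤ t)
    (h : ∀ ε > 0, ∃ δ > 0, ∀ s ∈ Icc 0 t, ∀ s' ∈ Icc s t, s' - s < δ →
      ‖F s' - F s - Φ s s'‖ ≤ ε * (s' - s)) :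
    Tendsto (fun N : ℕ ↦ ∑ i ∈ Finset.range (N + 1), Φ (gridPoint t N i) (gridPoint t N (i + 1)))
      atTop (𝓝 (F t - F 0)) := by
  rw [Metric.tendsto_atTop]
  intro ε hε
  obtain ⟨δ, hδ, hΦ⟩ := h (ε / (t + 1)) (by positivity)
  obtain ⟨N₀, hN₀⟩ := exists_nat_gt (t / δ)
  refine ⟨N₀, fun N hN ↦ ?_⟩
  have hmesh : t / ((N : ℝ) + 1) < δ := by
    have : (N₀ : ℝ) ≤ N := by exact_mod_cast hN
    rw [div_lt_iff₀ hδ] at hN₀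
    rw [div_lt_iff₀ (by positivity)]
    nlinarith
  have htel : ∀ G : ℝ → E, ∑ i ∈ Finset.range (N + 1),
      (G (gridPoint t N (i + 1)) - G (gridPoint t N i)) = G t - G 0 := fun G ↦ by
    rw [Finset.sum_range_sub (fun i ↦ G (gridPoint t N i)), gridPoint_last, gridPoint_zero ht]
  have htel' : ∑ i ∈ Finset.range (N + 1), (gridPoint t N (i + 1) - gridPoint t N i) = t := by
    rw [Finset.sum_range_sub (gridPoint t N), gridPoint_last, gridPoint_zero ht, sub_zero]
  rw [dist_comm, dist_eq_norm, ← htel F, ← Finset.sum_sub_distrib]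
  calc _ ≤ ∑ i ∈ Finset.range (N + 1),
        ε / (t + 1) * (gridPoint t N (i + 1) - gridPoint t N i) := by
        refine norm_sum_le_of_le _ fun i _ ↦ ?_
        exact hΦ _ (gridPoint_mem ht N i) _
          ⟨monotone_gridPoint ht N i.le_succ, (gridPoint_mem ht N _).2⟩
          ((gridPoint_succ_sub_le ht N i).trans_lt hmesh)
    _ = ε / (t + 1) * t := by rw [← Finset.mul_sum, htel']
    _ < ε := by
        rw [div_mul_eq_mul_div, div_lt_iff₀ (by positivity)]
        nlinarith

end

section

variable {T : ℝ} {u v : ℝ → ℝ}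

namespace DiffBddDeriv

lemma continuousOn (hu : DiffBddDeriv T u) : ContinuousOn u (Icc 0 T) := hu.1.continuousOn

lemma hasDerivWithinAt (hu : DiffBddDeriv T u) {t : ℝ} (ht : t ∈ Icc 0 T) :
    HasDerivWithinAt u (derivWithin u (Icc 0 T) t) (Icc 0 T) t :=
  (hu.1 t ht).hasDerivWithinAt

lemma exists_bound (hu : DiffBddDeriv T u) :
    ∃ C, 0 ≤ C ∧ ∀ t ∈ Icc 0 T, |u t| ≤ C := by
  obtain ⟨C, hC⟩ := isCompact_Icc.exists_bound_of_continuousOn hu.continuousOn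
  exact ⟨max C 0, le_max_right _ _, fun t ht ↦ (hC t ht).trans (le_max_left _ _)⟩

lemma of_hasDerivWithinAt (hT : 0 < T) {u' : ℝ → ℝ}
    (h : ∀ t ∈ Icc 0 T, HasDerivWithinAt u (u' t) (Icc 0 T) t)
    (hb : ∃ C, ∀ t ∈ Icc 0 T, |u' t| ≤ C) : DiffBddDeriv T u := by
  obtain ⟨C, hC⟩ := hb
  refine ⟨fun t ht ↦ (h t ht).differentiableWithinAt, C, fun t ht ↦ ?_⟩
  rw [(h t ht).derivWithin (uniqueDiffOn_Icc hT t ht)]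
  exact hC t ht

lemma mul (hT : 0 < T) (hu : DiffBddDeriv T u) (hv : DiffBddDeriv T v) :
    DiffBddDeriv T (fun t ↦ u t * v t) := by
  obtain ⟨A, hA0, hA⟩ := hu.exists_bound
  obtain ⟨B, hB0, hB⟩ := hv.exists_bound
  obtain ⟨A', hA'⟩ := hu.2
  obtain ⟨B', hB'⟩ := hv.2
  refine of_hasDerivWithinAt hT (fun t ht ↦ (hu.hasDerivWithinAt ht).mul (hv.hasDerivWithinAt ht))
    ⟨A' * B + A * B', fun t ht ↦ (abs_add_le _ _).trans ?_⟩
  rw [abs_mul, abs_mul]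
  have h1 := hA' t ht
  have h2 := hA t ht
  have h3 := (abs_nonneg _).trans h1
  gcongr
  exacts [hB t ht, hB' t ht]

lemma one_sub (hT : 0 < T) (hu : DiffBddDeriv T u) : DiffBddDeriv T (fun t ↦ 1 - u t) := by
  obtain ⟨A', hA'⟩ := hu.2
  exact of_hasDerivWithinAt hT (fun t ht ↦ (hu.hasDerivWithinAt ht).const_sub 1)
    ⟨A', fun t ht ↦ by rw [abs_neg]; exact hA' t ht⟩

lemma comp (hT : 0 < T) (hu : DiffBddDeriv T u) {φ φ' : ℝ → ℝ}
    (hφ : ∀ t ∈ Icc 0 T, HasDerivAt φ (φ' (u t)) (u t))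
    (hφ' : ContinuousOn (fun t ↦ φ' (u t)) (Icc 0 T)) : DiffBddDeriv T (fun t ↦ φ (u t)) := by
  obtain ⟨A', hA'⟩ := hu.2
  obtain ⟨C, hC⟩ := isCompact_Icc.exists_bound_of_continuousOn hφ'
  refine of_hasDerivWithinAt hT
    (fun t ht ↦ (hφ t ht).comp_hasDerivWithinAt t (hu.hasDerivWithinAt ht))
    ⟨C * A', fun t ht ↦ ?_⟩
  rw [abs_mul]
  have h1 : |φ' (u t)| ≤ C := hC t ht
  have h2 := (abs_nonneg _).trans h1
  gcongr
  exact hA' t ht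

lemma inv (hT : 0 < T) (hu : DiffBddDeriv T u) (h0 : ∀ t ∈ Icc 0 T, u t ≠ 0) :
    DiffBddDeriv T (fun t ↦ (u t)⁻¹) :=
  comp hT hu (φ' := fun x ↦ -(x ^ 2)⁻¹) (fun t ht ↦ hasDerivAt_inv (h0 t ht))
    ((hu.continuousOn.pow 2).inv₀ fun t ht ↦ pow_ne_zero 2 (h0 t ht)).neg

lemma log (hT : 0 < T) (hu : DiffBddDeriv T u) (h0 : ∀ t ∈ Icc 0 T, u t ≠ 0) :
    DiffBddDeriv T (fun t ↦ Real.log (u t)) :=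
  comp hT hu (φ' := fun x ↦ x⁻¹) (fun t ht ↦ Real.hasDerivAt_log (h0 t ht))
    (hu.continuousOn.inv₀ h0)

end DiffBddDeriv

lemma aemeasurable_derivWithin_Icc (u : ℝ → ℝ) (T : ℝ) :
    AEMeasurable (derivWithin u (Icc 0 T)) (volume.restrict (Icc 0 T)) := by
  refine (measurable_deriv u).aemeasurable.congr ?_
  rw [← Measure.restrict_congr_set Ioo_ae_eq_Icc]
  filter_upwards [ae_restrict_mem measurableSet_Ioo] with x hx
  exact (derivWithin_of_mem_nhds (Icc_mem_nhds hx.1 hx.2)).symm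

lemma intervalIntegrable_of_bounded {w : ℝ → ℝ}
    (hw : AEMeasurable w (volume.restrict (Icc 0 T))) {C : ℝ} (hC : ∀ t ∈ Icc 0 T, |w t| ≤ C)
    {s t : ℝ} (hs : s ∈ Icc 0 T) (ht : t ∈ Icc s T) : IntervalIntegrable w volume s t := by
  rw [intervalIntegrable_iff_integrableOn_Icc_of_le ht.1]
  have hsub : Icc s t ⊆ Icc 0 T := Icc_subset_Icc hs.1 ht.2
  refine Integrable.of_bound
    (hw.aestronglyMeasurable.mono_measure (Measure.restrict_mono hsub le_rfl)) C ?_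
  filter_upwards [ae_restrict_mem measurableSet_Icc] with x hx using hC x (hsub hx)

lemma DiffBddDeriv.intervalIntegrable (hu : DiffBddDeriv T u) {s t : ℝ} (hs : s ∈ Icc 0 T)
    (ht : t ∈ Icc s T) : IntervalIntegrable (derivWithin u (Icc 0 T)) volume s t := by
  obtain ⟨C, hC⟩ := hu.2
  exact intervalIntegrable_of_bounded (aemeasurable_derivWithin_Icc u T) hC hs ht

lemma DiffBddDeriv.integral_derivWithin (hu : DiffBddDeriv T u) {s t : ℝ} (hs : s ∈ Icc 0 T)
    (ht : t ∈ Icc s T) : ∫ r in s..t, derivWithin u (Icc 0 T) r = u t - u s := by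
  refine intervalIntegral.integral_eq_sub_of_hasDerivAt_of_le ht.1
    (hu.continuousOn.mono (Icc_subset_Icc hs.1 ht.2)) (fun x hx ↦ ?_) (hu.intervalIntegrable hs ht)
  have h0 : 0 < x := hs.1.trans_lt hx.1
  have hT : x < T := hx.2.trans_le ht.2
  exact (hu.hasDerivWithinAt ⟨h0.le, hT.le⟩).hasDerivAt (Icc_mem_nhds h0 hT)

end

section

variable {T : ℝ} {d : ℕ}

/-- Variation of constants along a path: if `-f k` and `h k` are the derivatives of `k` and `b`, the path
`k x - b y` has the increments of `∫ k dM`. -/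
lemma tendsto_sum_smul_increment {f h k b : ℝ → ℝ}
    (hk : DiffBddDeriv T k) (hb : DiffBddDeriv T b)
    (hk' : ∀ r ∈ Icc 0 T, derivWithin k (Icc 0 T) r = -(f r * k r))
    (hb' : ∀ r ∈ Icc 0 T, derivWithin b (Icc 0 T) r = h r * k r)
    {A B : ℝ} (hA : ∀ r ∈ Icc 0 T, |f r| ≤ A) (hB : ∀ r ∈ Icc 0 T, |h r| ≤ B)
    {x M : ℝ → Space d} {y : Space d} (hx : ContinuousOn x (Icc 0 T))
    (hint : IntervalIntegrable (fun s ↦ f s • x s + h s • y) volume 0 T)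
    (heq : ∀ t ∈ Icc 0 T, x t = x 0 + (∫ s in (0 : ℝ)..t, (f s • x s + h s • y)) + M t)
    {t : ℝ} (ht : t ∈ Icc 0 T) :
    Tendsto (fun N : ℕ ↦ ∑ i ∈ Finset.range (N + 1),
      k (gridPoint t N i) • (M (gridPoint t N (i + 1)) - M (gridPoint t N i)))
      atTop (𝓝 ((k t • x t - b t • y) - (k 0 • x 0 - b 0 • y))) := by
  refine tendsto_sum_gridPoint (F := fun t ↦ k t • x t - b t • y)
    (Φ := fun s s' ↦ k s • (M s' - M s)) ht.1 fun ε hε ↦ ?_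
  have hA0 : 0 ≤ A := (abs_nonneg _).trans (hA t ht)
  have hB0 : 0 ≤ B := (abs_nonneg _).trans (hB t ht)
  have huc1 : UniformContinuousOn (fun p : ℝ × ℝ ↦ k p.1 • x p.2) (Icc 0 T ×ˢ Icc 0 T) := by
    refine (isCompact_Icc.prod isCompact_Icc).uniformContinuousOn_of_continuous ?_
    exact (hk.continuousOn.comp continuousOn_fst fun p hp ↦ hp.1).smul
      (hx.comp continuousOn_snd fun p hp ↦ hp.2)
  have huc2 := isCompact_Icc.uniformContinuousOn_of_continuous hk.continuousOn
  rw [Metric.uniformContinuousOn_iff] at huc1 huc2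
  obtain ⟨δ₁, hδ₁, h₁⟩ := huc1 (ε / (A + B * ‖y‖ + 1)) (by positivity)
  obtain ⟨δ₂, hδ₂, h₂⟩ := huc2 (ε / (A + B * ‖y‖ + 1)) (by positivity)
  refine ⟨min δ₁ δ₂, lt_min hδ₁ hδ₂, fun s hs s' hs' hss ↦ ?_⟩
  have hsT : s ∈ Icc 0 T := ⟨hs.1, hs.2.trans ht.2⟩
  have hs'T : s' ∈ Icc s T := ⟨hs'.1, hs'.2.trans ht.2⟩
  have hs'0 : s' ∈ Icc 0 T := ⟨hs.1.trans hs'.1, hs'T.2⟩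
  have hT0 : 0 ≤ T := hsT.1.trans hsT.2
  have hint' : ∀ {p q : ℝ}, p ∈ Icc 0 T → q ∈ Icc 0 T →
      IntervalIntegrable (fun s ↦ f s • x s + h s • y) volume p q := fun hp hq ↦
    hint.mono_set (uIcc_subset_uIcc (by rwa [uIcc_of_le hT0]) (by rwa [uIcc_of_le hT0]))
  have hM : M s' - M s = x s' - x s - ∫ r in s..s', (f r • x r + h r • y) := by
    rw [← intervalIntegral.integral_interval_sub_left (hint' ⟨le_rfl, hT0⟩ hs'0) (hint' ⟨le_rfl, hT0⟩ hsT)]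
    have e1 := heq s hsT
    have e2 := heq s' hs'0
    rw [e1, e2]
    abel
  have hik : IntervalIntegrable (fun r ↦ derivWithin k (Icc 0 T) r • x s') volume s s' :=
    ⟨(hk.intervalIntegrable hsT hs'T).1.smul_const _,
      (hk.intervalIntegrable hsT hs'T).2.smul_const _⟩
  have hib : IntervalIntegrable (fun r ↦ derivWithin b (Icc 0 T) r • y) volume s s' :=
    ⟨(hb.intervalIntegrable hsT hs'T).1.smul_const _,
      (hb.intervalIntegrable hsT hs'T).2.smul_const _⟩
  have hid : IntervalIntegrable (fun r ↦ k s • (f r • x r + h r • y)) volume s s' :=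
    (hint' hsT hs'0).smul (k s)
  have hexp : (k s' • x s' - b s' • y) - (k s • x s - b s • y) - k s • (M s' - M s)
      = ∫ r in s..s', (derivWithin k (Icc 0 T) r • x s' - derivWithin b (Icc 0 T) r • y
          + k s • (f r • x r + h r • y)) := by
    rw [intervalIntegral.integral_add (by exact hik.sub hib) hid,
      intervalIntegral.integral_sub hik hib, intervalIntegral.integral_smul_const,
      intervalIntegral.integral_smul_const, intervalIntegral.integral_smul,
      hk.integral_derivWithin hsT hs'T, hb.integral_derivWithin hsT hs'T, hM]
    module
  rw [hexp]
  rw [← abs_of_nonneg (sub_nonneg.2 hs'.1)]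
  refine intervalIntegral.norm_integral_le_of_norm_le_const fun r hr ↦ ?_
  rw [uIoc_of_le hs'.1] at hr
  have hrT : r ∈ Icc 0 T := ⟨hsT.1.trans hr.1.le, hr.2.trans hs'T.2⟩
  have hrearr : derivWithin k (Icc 0 T) r • x s' - derivWithin b (Icc 0 T) r • y
      + k s • (f r • x r + h r • y)
      = f r • (k s • x r - k r • x s') + (h r * (k s - k r)) • y := by
    rw [hk' r hrT, hb' r hrT]
    module
  have hd1 : dist s r < min δ₁ δ₂ := by
    rw [Real.dist_eq, abs_sub_comm, abs_of_nonneg (by linarith [hr.1])]; linarith [hr.2]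
  have hd2 : dist r s' < min δ₁ δ₂ := by
    rw [Real.dist_eq, abs_sub_comm, abs_of_nonneg (by linarith [hr.2])]; linarith [hr.1]
  have b1 : ‖k s • x r - k r • x s'‖ ≤ ε / (A + B * ‖y‖ + 1) := by
    rw [← dist_eq_norm]
    refine (h₁ (s, r) ⟨hsT, hrT⟩ (r, s') ⟨hrT, hs'0⟩ ?_).le
    rw [Prod.dist_eq]
    exact (max_lt hd1 hd2).trans_le (min_le_left _ _)
  have b2 : |k s - k r| ≤ ε / (A + B * ‖y‖ + 1) :=
    (h₂ s hsT r hrT (hd1.trans_le (min_le_right _ _))).le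
  rw [hrearr]
  calc _ ≤ |f r| * ‖k s • x r - k r • x s'‖ + |h r| * |k s - k r| * ‖y‖ := by
        refine (norm_add_le _ _).trans (le_of_eq ?_)
        rw [norm_smul, norm_smul, Real.norm_eq_abs, Real.norm_eq_abs, abs_mul]
    _ ≤ A * (ε / (A + B * ‖y‖ + 1)) + B * (ε / (A + B * ‖y‖ + 1)) * ‖y‖ := by
        gcongr
        exacts [hA r hrT, hB r hrT]
    _ = ε * (A + B * ‖y‖) / (A + B * ‖y‖ + 1) := by ring
    _ ≤ ε := by
        rw [div_le_iff₀ (by positivity)]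
        nlinarith

lemma tendsto_sum_sq_mul_integral {w k v : ℝ → ℝ} (hk : ContinuousOn k (Icc 0 T))
    (hv : DiffBddDeriv T v) (hw : AEMeasurable w (volume.restrict (Icc 0 T)))
    {A : ℝ} (hA : ∀ r ∈ Icc 0 T, |w r| ≤ A)
    (hv' : ∀ r ∈ Icc 0 T, derivWithin v (Icc 0 T) r = k r ^ 2 * w r)
    {t : ℝ} (ht : t ∈ Icc 0 T) :
    Tendsto (fun N : ℕ ↦ ∑ i ∈ Finset.range (N + 1),
      k (gridPoint t N i) ^ 2 * ∫ s in gridPoint t N i..gridPoint t N (i + 1), w s)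
      atTop (𝓝 (v t - v 0)) := by
  refine tendsto_sum_gridPoint (Φ := fun s s' ↦ k s ^ 2 * ∫ r in s..s', w r) ht.1 fun ε hε ↦ ?_
  have hA0 : 0 ≤ A := (abs_nonneg _).trans (hA t ht)
  have huc := isCompact_Icc.uniformContinuousOn_of_continuous (hk.pow 2)
  rw [Metric.uniformContinuousOn_iff] at huc
  obtain ⟨δ, hδ, h⟩ := huc (ε / (A + 1)) (by positivity)
  refine ⟨δ, hδ, fun s hs s' hs' hss ↦ ?_⟩
  have hsT : s ∈ Icc 0 T := ⟨hs.1, hs.2.trans ht.2⟩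
  have hs'T : s' ∈ Icc s T := ⟨hs'.1, hs'.2.trans ht.2⟩
  rw [← hv.integral_derivWithin hsT hs'T, ← intervalIntegral.integral_const_mul,
    ← intervalIntegral.integral_sub (hv.intervalIntegrable hsT hs'T)
      ((intervalIntegrable_of_bounded hw hA hsT hs'T).const_mul _),
    ← abs_of_nonneg (sub_nonneg.2 hs'.1)]
  refine intervalIntegral.norm_integral_le_of_norm_le_const fun r hr ↦ ?_
  rw [uIoc_of_le hs'.1] at hr
  have hrT : r ∈ Icc 0 T := ⟨hsT.1.trans hr.1.le, hr.2.trans hs'T.2⟩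
  have hd : dist r s < δ := by
    rw [Real.dist_eq, abs_of_nonneg (by linarith [hr.1])]; linarith [hr.2]
  have hb : |k r ^ 2 - k s ^ 2| ≤ ε / (A + 1) := (h r hrT s hsT hd).le
  rw [hv' r hrT, ← sub_mul, Real.norm_eq_abs, abs_mul]
  calc _ ≤ ε / (A + 1) * A := by gcongr; exact hA r hrT
    _ ≤ ε := by
        rw [div_mul_eq_mul_div, div_le_iff₀ (by positivity)]
        nlinarith

end

section

variable {Ω : Type*} {mΩ : MeasurableSpace Ω} {d : ℕ} {P : Measure Ω}
  {𝓕 : Filtration ℝ mΩ} {T : ℝ} {W : ℝ → Ω → Space d}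

lemma IsLinearSDESolution.isGaussianGiven [IsProbabilityMeasure P]
    (hW : IsWienerProcess 𝓕 P T W) {f h g k b v : ℝ → ℝ} {xhat : Ω → Space d}
    {X : ℝ → Ω → Space d} (hX : IsLinearSDESolution 𝓕 P T W f h g xhat X)
    (hk : DiffBddDeriv T k) (hb : DiffBddDeriv T b) (hv : DiffBddDeriv T v)
    (hk' : ∀ r ∈ Icc 0 T, derivWithin k (Icc 0 T) r = -(f r * k r))
    (hb' : ∀ r ∈ Icc 0 T, derivWithin b (Icc 0 T) r = h r * k r)
    (hv' : ∀ r ∈ Icc 0 T, derivWithin v (Icc 0 T) r = k r ^ 2 * g r ^ 2)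
    {A B K : ℝ} (hA : ∀ r ∈ Icc 0 T, |f r| ≤ A) (hB : ∀ r ∈ Icc 0 T, |h r| ≤ B)
    (hK : ∀ r ∈ Icc 0 T, |g r| ≤ K) (hg : AEMeasurable g (volume.restrict (Icc 0 T)))
    {t : ℝ} (ht : t ∈ Icc 0 T) :
    IsGaussianGiven (𝓕 0) P
      (fun ω ↦ (k t • X t ω - b t • xhat ω) - (k 0 • X 0 ω - b 0 • xhat ω)) (v t - v 0) := by
  obtain ⟨M, hM, hXM⟩ := hX.integral_eq
  have hgridT : ∀ N i, gridPoint t N i ∈ Icc 0 T := fun N i ↦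
    ⟨(gridPoint_mem ht.1 N i).1, (gridPoint_mem ht.1 N i).2.trans ht.2⟩
  refine IsGaussianGiven.of_tendsto_ae (𝓕.le 0)
    (D := fun N ω ↦ ∑ i ∈ Finset.range (N + 1),
      k (gridPoint t N i) • (M (gridPoint t N (i + 1)) ω - M (gridPoint t N i) ω))
    (q := fun N ↦ ∑ i ∈ Finset.range (N + 1),
      k (gridPoint t N i) ^ 2 * ∫ s in gridPoint t N i..gridPoint t N (i + 1), g s ^ 2)
    (fun N ↦ Finset.aestronglyMeasurable_fun_sum _ fun i _ ↦
      ((hM.1 _ (hgridT N _)).sub (hM.1 _ (hgridT N _))).const_smul (k (gridPoint t N i)))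
    (fun N ↦ ?_) ?_ ?_
  · have := hM.isGaussianGiven_sum hW hg hK (monotone_gridPoint ht.1 N) (hgridT N)
      (fun i ↦ k (gridPoint t N i)) (N + 1)
    rwa [gridPoint_zero ht.1] at this
  · filter_upwards [hX.continuous, hX.drift_integrable, hXM] with ω h1 h2 h3
    exact tendsto_sum_smul_increment hk hb hk' hb' hA hB h1 h2 h3 ht
  · refine tendsto_sum_sq_mul_integral hk.continuousOn hv (hg.pow_const 2) (A := K ^ 2)
      (fun r hr ↦ ?_) hv' ht
    rw [abs_pow]
    have := hK r hr
    gcongr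

lemma condDistrib_affine [IsProbabilityMeasure P] {β : Type*} [MeasurableSpace β] {U : Ω → β}
    (hU : Measurable U) {Y N : Ω → Space d} (hY : Measurable Y) (hN : Measurable N) {q : ℝ}
    (hq : 0 ≤ q) (hprod : P.map (fun ω ↦ (U ω, N ω)) = (P.map U).prod (isoGaussian 0 q))
    {μ : β → Space d} (hμ : Measurable μ) (a : ℝ) (hYN : ∀ ω, Y ω = μ (U ω) + a • N ω) :
    ∀ᵐ p ∂(P.map U), condDistrib Y U P p = isoGaussian (μ p) (a ^ 2 * q) := by
  set φ : β × Space d → Space d := fun z ↦ μ z.1 + a • z.2 with hφ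
  have hφm : Measurable φ := by fun_prop
  set κ : Kernel β (Space d) := (Kernel.id ×ₖ Kernel.const β (isoGaussian 0 q)).map φ with hκ
  have : IsMarkovKernel κ := Kernel.IsMarkovKernel.map _ hφm
  have hκp : ∀ p, κ p = (isoGaussian 0 q).map (fun n ↦ φ (p, n)) := by
    intro p
    rw [hκ, Kernel.map_apply _ hφm, Kernel.prod_apply, Kernel.id_apply, Kernel.const_apply,
      Measure.dirac_prod, Measure.map_map hφm (by fun_prop)]
    rfl
  have hmain : P.map (fun ω ↦ (U ω, Y ω)) = P.map U ⊗ₘ κ := by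
    have : P.map (fun ω ↦ (U ω, Y ω))
        = (P.map (fun ω ↦ (U ω, N ω))).map (fun z ↦ (z.1, φ z)) := by
      rw [Measure.map_map (by fun_prop) (by fun_prop)]
      congr 1
      ext1 ω
      exact Prod.ext rfl (hYN ω)
    rw [this, hprod]
    have := Measure.isProbabilityMeasure_map (μ := P) hU.aemeasurable
    ext s hs
    have hpair : Measurable (fun z : β × Space d ↦ (z.1, φ z)) := by fun_prop
    rw [Measure.map_apply hpair hs, Measure.prod_apply (hpair hs), Measure.compProd_apply hs]
    refine lintegral_congr fun p ↦ ?_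
    rw [hκp, Measure.map_apply (by fun_prop) (measurable_prodMk_left hs)]
    rfl
  filter_upwards [condDistrib_ae_eq_of_measure_eq_compProd U hY.aemeasurable hmain] with p hp
  rw [hp, hκp]
  exact map_add_smul_isoGaussian (μ p) a hq

end

section

variable {T : ℝ} {α σ η : ℝ → ℝ}

/-- The signal coefficient `α_t (1 - η_t)` of `x₀`. -/
def signalScale (α η : ℝ → ℝ) (t : ℝ) : ℝ := α t * (1 - η t)

lemma diffBddDeriv_signalScale (hT : 0 < T) (hα : DiffBddDeriv T α) (hη : DiffBddDeriv T η) :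
    DiffBddDeriv T (signalScale α η) :=
  hα.mul hT (hη.one_sub hT)

lemma signalScale_pos (hα_pos : ∀ t ∈ Icc 0 T, 0 < α t) (hη_lt : ∀ t ∈ Icc 0 T, η t < 1)
    {t : ℝ} (ht : t ∈ Icc 0 T) : 0 < signalScale α η t :=
  mul_pos (hα_pos t ht) (sub_pos.2 (hη_lt t ht))

lemma coeffF_eq (hT : 0 < T) (ha : DiffBddDeriv T (signalScale α η)) {t : ℝ} (ht : t ∈ Icc 0 T)
    (h0 : signalScale α η t ≠ 0) : coeffF T α η t
      = derivWithin (signalScale α η) (Icc 0 T) t / signalScale α η t :=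
  ((ha.hasDerivWithinAt ht).log h0).derivWithin (uniqueDiffOn_Icc hT t ht)

lemma derivWithin_inv_signalScale (hT : 0 < T) (ha : DiffBddDeriv T (signalScale α η)) {t : ℝ}
    (ht : t ∈ Icc 0 T) (h0 : signalScale α η t ≠ 0) :
    derivWithin (fun s ↦ (signalScale α η s)⁻¹) (Icc 0 T) t
      = -(coeffF T α η t * (signalScale α η t)⁻¹) := by
  rw [((ha.hasDerivWithinAt ht).fun_inv h0).derivWithin (uniqueDiffOn_Icc hT t ht),
    coeffF_eq hT ha ht h0]
  field_simp

lemma derivWithin_inv_one_sub (hT : 0 < T) (hη : DiffBddDeriv T η) {t : ℝ}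
    (ht : t ∈ Icc 0 T) (hα0 : α t ≠ 0) (h0 : 1 - η t ≠ 0) :
    derivWithin (fun s ↦ (1 - η s)⁻¹) (Icc 0 T) t
      = coeffH T α η t * (signalScale α η t)⁻¹ := by
  rw [(((hη.hasDerivWithinAt ht).const_sub 1).fun_inv h0).derivWithin (uniqueDiffOn_Icc hT t ht),
    coeffH, signalScale]
  field_simp

lemma derivWithin_sq_mul_inv_sq (hT : 0 < T) (ha : DiffBddDeriv T (signalScale α η))
    (hσ : DiffBddDeriv T (fun t ↦ σ t ^ 2)) {t : ℝ}
    (ht : t ∈ Icc 0 T) (h0 : signalScale α η t ≠ 0) :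
    derivWithin (fun s ↦ σ s ^ 2 * ((signalScale α η s)⁻¹ * (signalScale α η s)⁻¹)) (Icc 0 T) t
      = (signalScale α η t)⁻¹ ^ 2 * coeffGSq T α σ η t := by
  have hi := (ha.hasDerivWithinAt ht).fun_inv h0
  rw [((hσ.hasDerivWithinAt ht).fun_mul (hi.fun_mul hi)).derivWithin (uniqueDiffOn_Icc hT t ht)]
  change _ = _ * (_ - 2 * coeffF T α η t * _)
  rw [coeffF_eq hT ha ht h0]
  field_simp
  ring

lemma exists_bound_coeffF (hT : 0 < T) (ha : DiffBddDeriv T (signalScale α η))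
    (h0 : ∀ t ∈ Icc 0 T, signalScale α η t ≠ 0) : ∃ A, ∀ t ∈ Icc 0 T, |coeffF T α η t| ≤ A :=
  (ha.log hT h0).2

lemma exists_bound_coeffH (hα : DiffBddDeriv T α) (hη : DiffBddDeriv T η)
    (h0 : ∀ t ∈ Icc 0 T, 1 - η t ≠ 0) : ∃ B, ∀ t ∈ Icc 0 T, |coeffH T α η t| ≤ B := by
  obtain ⟨C, hC⟩ := hη.2
  obtain ⟨D, hD⟩ := isCompact_Icc.exists_bound_of_continuousOn
    (hα.continuousOn.div (continuousOn_const.sub hη.continuousOn) h0)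
  refine ⟨D * C, fun t ht ↦ ?_⟩
  rw [coeffH, abs_mul]
  have h1 : |α t / (1 - η t)| ≤ D := hD t ht
  have h2 := (abs_nonneg _).trans h1
  gcongr
  exact hC t ht

lemma exists_bound_coeffG (hT : 0 < T) (ha : DiffBddDeriv T (signalScale α η))
    (h0 : ∀ t ∈ Icc 0 T, signalScale α η t ≠ 0) (hσ : DiffBddDeriv T (fun t ↦ σ t ^ 2)) :
    ∃ K, ∀ t ∈ Icc 0 T, |coeffG T α σ η t| ≤ K := by
  obtain ⟨A, hA⟩ := exists_bound_coeffF hT ha h0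
  obtain ⟨C, hC⟩ := hσ.2
  obtain ⟨D, hD0, hD⟩ := hσ.exists_bound
  refine ⟨√(C + 2 * A * D), fun t ht ↦ ?_⟩
  rw [coeffG, abs_of_nonneg (Real.sqrt_nonneg _)]
  refine Real.sqrt_le_sqrt ((le_abs_self _).trans ((abs_sub _ _).trans ?_))
  have h1 := hA t ht
  have h2 := (abs_nonneg _).trans h1
  refine add_le_add (hC t ht) ?_
  rw [abs_mul, abs_mul, abs_two]
  gcongr
  exacts [h1, hD t ht]

lemma aemeasurable_coeffG (hσ : DiffBddDeriv T (fun t ↦ σ t ^ 2)) :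
    AEMeasurable (coeffG T α σ η) (volume.restrict (Icc 0 T)) :=
  ((aemeasurable_derivWithin_Icc _ T).sub (((aemeasurable_derivWithin_Icc _ T).const_mul 2).mul
    (hσ.continuousOn.aemeasurable measurableSet_Icc))).sqrt

end

end DoS

theorem mainTheorem2 {d : ℕ} {T : ℝ} (hT : 0 < T)
    (α σ η : ℝ → ℝ)
    (hα : DoS.DiffBddDeriv T α) (hη : DoS.DiffBddDeriv T η)
    (hσ : DoS.DiffBddDeriv T (fun t ↦ σ t ^ 2))
    (hα_pos : ∀ t ∈ Icc 0 T, 0 < α t) (hη_lt : ∀ t ∈ Icc 0 T, η t < 1)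
    (hα₀ : α 0 = 1) (hσ₀ : σ 0 = 0) (hη₀ : η 0 = 0)
    (hg : ∀ t ∈ Icc 0 T, 0 ≤ DoS.coeffGSq T α σ η t)
    {Ω : Type*} {mΩ : MeasurableSpace Ω} (P : Measure Ω) [IsProbabilityMeasure P]
    (𝓕 : Filtration ℝ mΩ) (W : ℝ → Ω → DoS.Space d) (hW : DoS.IsWienerProcess 𝓕 P T W)
    (xhat : Ω → DoS.Space d) (hxhat : Measurable[𝓕 0] xhat)
    (X : ℝ → Ω → DoS.Space d)
    (hX : DoS.IsLinearSDESolution 𝓕 P T W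
      (DoS.coeffF T α η) (DoS.coeffH T α η) (DoS.coeffG T α σ η) xhat X)
    (t : ℝ) (ht : t ∈ Icc 0 T) :
    (∀ᵐ p ∂(P.map (fun ω ↦ (X 0 ω, xhat ω))),
      condDistrib (X t) (fun ω ↦ (X 0 ω, xhat ω)) P p
        = DoS.domainShiftGaussian α σ η t p.1 p.2) ∧
    (∀ x₀ xhat₀ : DoS.Space d, (∀ᵐ ω ∂P, X 0 ω = x₀) → (∀ᵐ ω ∂P, xhat ω = xhat₀) →
      HasLaw (X t) (DoS.domainShiftGaussian α σ η t x₀ xhat₀) P) := by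
  have ha := DoS.diffBddDeriv_signalScale hT hα hη
  have ha0 : ∀ s ∈ Icc 0 T, DoS.signalScale α η s ≠ 0 := fun s hs ↦
    (DoS.signalScale_pos hα_pos hη_lt hs).ne'
  have hη0 : ∀ s ∈ Icc 0 T, 1 - η s ≠ 0 := fun s hs ↦ (sub_pos.2 (hη_lt s hs)).ne'
  have hk := ha.inv hT ha0
  obtain ⟨A, hA⟩ := DoS.exists_bound_coeffF hT ha ha0
  obtain ⟨B, hB⟩ := DoS.exists_bound_coeffH hα hη hη0
  obtain ⟨K, hK⟩ := DoS.exists_bound_coeffG hT ha ha0 hσ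
  have hG := hX.isGaussianGiven hW hk ((hη.one_sub hT).inv hT hη0) (hσ.mul hT (hk.mul hT hk))
    (fun r hr ↦ DoS.derivWithin_inv_signalScale hT ha hr (ha0 r hr))
    (fun r hr ↦ DoS.derivWithin_inv_one_sub hT hη hr (hα_pos r hr).ne' (hη0 r hr))
    (fun r hr ↦ by
      rw [DoS.derivWithin_sq_mul_inv_sq hT ha hσ hr (ha0 r hr), DoS.coeffG,
        Real.sq_sqrt (hg r hr)])
    hA hB hK (DoS.aemeasurable_coeffG hσ) ht
  have h0T : (0 : ℝ) ∈ Icc 0 T := ⟨le_rfl, hT.le⟩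
  have hX0 : Measurable (X 0) := (hX.adapted 0 h0T).mono (𝓕.le 0) le_rfl
  have hXt : Measurable (X t) := (hX.adapted t ht).mono (𝓕.le t) le_rfl
  have hxh : Measurable xhat := hxhat.mono (𝓕.le 0) le_rfl
  have hat := ha0 t ht
  have hηt := hη0 t ht
  have hq0 : 0 ≤ σ t ^ 2 * ((DoS.signalScale α η t)⁻¹ * (DoS.signalScale α η t)⁻¹)
      - σ 0 ^ 2 * ((DoS.signalScale α η 0)⁻¹ * (DoS.signalScale α η 0)⁻¹) := by
    rw [hσ₀, ← sq]
    simp only [ne_eq, OfNat.ofNat_ne_zero, not_false_eq_true, zero_pow, zero_mul, sub_zero]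
    positivity
  have hqa : DoS.signalScale α η t ^ 2
      * (σ t ^ 2 * ((DoS.signalScale α η t)⁻¹ * (DoS.signalScale α η t)⁻¹)
      - σ 0 ^ 2 * ((DoS.signalScale α η 0)⁻¹ * (DoS.signalScale α η 0)⁻¹)) = σ t ^ 2 := by
    rw [hσ₀]
    field_simp
    simp
  set N : Ω → DoS.Space d := fun ω ↦
    ((DoS.signalScale α η t)⁻¹ • X t ω - (1 - η t)⁻¹ • xhat ω)
      - ((DoS.signalScale α η 0)⁻¹ • X 0 ω - (1 - η 0)⁻¹ • xhat ω) with hNdef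
  have hN : Measurable N := by fun_prop
  have hXN : ∀ ω, X t ω = α t • (η t • xhat ω + (1 - η t) • X 0 ω)
      + DoS.signalScale α η t • N ω := by
    intro ω
    have h1 : DoS.signalScale α η 0 = 1 := by simp [DoS.signalScale, hα₀, hη₀]
    have h2 : DoS.signalScale α η t * (1 - η t)⁻¹ = α t := by
      rw [DoS.signalScale]; field_simp
    simp only [hNdef, h1, hη₀, sub_zero, inv_one, one_smul, smul_sub, smul_smul,
      mul_inv_cancel₀ hat, h2]
    rw [DoS.signalScale]
    module
  refine ⟨?_, fun x₀ xhat₀ hx₀ hxhat₀ ↦ ?_⟩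
  · have hprod := hG.hasLaw_prod (𝓕.le 0) hq0 hN.aemeasurable
      ((hX.adapted 0 h0T).prodMk hxhat)
    have hc := DoS.condDistrib_affine (hX0.prodMk hxh) hXt hN hq0 hprod
      (μ := fun p ↦ α t • (η t • p.2 + (1 - η t) • p.1)) (by fun_prop)
      (DoS.signalScale α η t) hXN
    rwa [hqa] at hc
  · have hlaw := hG.hasLaw (𝓕.le 0) hq0 hN.aemeasurable
    refine ⟨hXt.aemeasurable, ?_⟩
    have hae : X t =ᵐ[P] (fun n ↦ α t • (η t • xhat₀ + (1 - η t) • x₀)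
        + DoS.signalScale α η t • n) ∘ N := by
      filter_upwards [hx₀, hxhat₀] with ω h1 h2
      rw [hXN ω, h1, h2]
      rfl
    rw [Measure.map_congr hae, ← Measure.map_map (by fun_prop) hN,
      hlaw.map_eq, DoS.map_add_smul_isoGaussian _ _ hq0, hqa]
    rfl
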